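/- Let $N\ge 1$ be an integer and let $f\in C^1([0,\infty))$ satisfy $f(0)=f(1)=0$, $f(s)<0$ for $0<s<1$, $f(s)>0$ for $s>1$, and $f'(1)=0$. For $R>0$ let $B_R\subset\mathbb R^N$ be the open ball of radius $R$ centred at the origin, with outer unit normal $\nu$ on $\partial B_R$, and consider the problem $$ -\operatorname{div}\left(\frac{\nabla u}{\sqrt{1-|\nabla u|^2}}\right)=f(u)\ \text{ in } B_R,\qquad u>0,\ u\text{ radial, in } B_R,\qquad \partial_\nu u=0\ \text{ on }\partial B_R, \tag{P} $$ where a solution is a function $u\in C^2(\overline{B_R})$ with $|\nabla u|<1$ in $B_R$ that satisfies (P) pointwise; being radial, it is also written $u(x)=u(r)$, $r=|x|$. Then for every integer $k\ge 1$ there is a threshold $R_k^*>0$ (depending on $N$, $f$, $k$) such that, for every $R\ge R_k^*$, problem (P) admits $4k$ pairwise distinct non-constant solutions $u_1^\pm,\dots,u_{2k}^\pm$ with the following properties: 1. $u_j^+(0)>1$ for every $j=1,\dots,2k$; 2. $u_j^-(0)<1$ for every $j=1,\dots,2k$; 3. for every $j=1,\dots,k$, each of the four functions $u_j^+(r)-1$,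 $u_j^-(r)-1$, $u_{2k+1-j}^+(r)-1$, $u_{2k+1-j}^-(r)-1$ has exactly $j$ zeros $r\in(0,R)$. -/

import Mathlib

open Set

namespace LorentzMinkowski

/-- Divergence of a vector field on Euclidean space: the sum of the partial derivatives
of the i-th component in the i-th coordinate direction. -/
noncomputable def divergence {N : ℕ}
    (F : EuclideanSpace ℝ (Fin N) → EuclideanSpace ℝ (Fin N))
    (x : EuclideanSpace ℝ (Fin N)) : ℝ :=
  ∑ i : Fin N, (fderiv ℝ F x (EuclideanSpace.single i 1)) i

/-- The vector field `∇w / √(1 - |∇w|²)`. -/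
noncomputable def flux {N : ℕ} (w : EuclideanSpace ℝ (Fin N) → ℝ)
    (x : EuclideanSpace ℝ (Fin N)) : EuclideanSpace ℝ (Fin N) :=
  (1 / Real.sqrt (1 - ‖gradient w x‖ ^ 2)) • gradient w x

/-- `w` is a positive classical solution of the Neumann problem
`-div (∇w / √(1 - |∇w|²)) = f(w)` in the ball `B_R` of `ℝ^N`, `∂_ν w = 0` on its boundary.
Only the values of `w` on the closed ball matter: derivatives in the open ball are two-sided,
and the normal derivative at the boundary is taken within the closed ball, on which `w` is `C²`
up to the boundary. -/
structure IsPositiveNeumannSolution {N : ℕ} (f : ℝ → ℝ) (R : ℝ)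
    (w : EuclideanSpace ℝ (Fin N) → ℝ) : Prop where
  contDiffOn : ContDiffOn ℝ 2 w (Metric.closedBall 0 R)
  /-- the gradient is spacelike, so that the operator is defined -/
  norm_gradient_lt_one : ∀ x ∈ Metric.ball (0 : EuclideanSpace ℝ (Fin N)) R,
    ‖gradient w x‖ < 1
  equation : ∀ x ∈ Metric.ball (0 : EuclideanSpace ℝ (Fin N)) R,
    -divergence (flux w) x = f (w x)
  pos : ∀ x ∈ Metric.ball (0 : EuclideanSpace ℝ (Fin N)) R, 0 < w x
  /-- the outer unit normal at a boundary point `x` is `x / R` -/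
  neumann : ∀ x ∈ Metric.sphere (0 : EuclideanSpace ℝ (Fin N)) R,
    fderivWithin ℝ w (Metric.closedBall 0 R) x (R⁻¹ • x) = 0

/-- `u = u(r)` is the profile of a radial positive solution `x ↦ u(|x|)` on the ball `B_R`
of `ℝ^N`. -/
def IsRadialSolution (N : ℕ) (f : ℝ → ℝ) (R : ℝ) (u : ℝ → ℝ) : Prop :=
  IsPositiveNeumannSolution f R (fun x : EuclideanSpace ℝ (Fin N) => u ‖x‖)

end LorentzMinkowski

/-!
Radial solutions are found by shooting from the origin. Write `N = n + 1` and
`y = u' / √(1 - u'²)`. For a radial function `u(|x|)` the equation becomes `u' = y / √(1 + y²)`,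
`y' = -f(u) - (n / r) y`, with `u(0) = d` and `y(0) = 0`. The Neumann condition at `R` says
`y(R) = 0`, so it suffices to follow the clockwise angle `θ_d(r)` of `(u - 1, y)` around the equilibrium `(1, 0)`:
the solutions with `θ_d(R) = j π` are the wanted ones. The axis `u = 1` is only ever crossed
clockwise, so such a solution takes the value `1` exactly `j` times in `(0, R)`
(`encard_cos_eq_zero`).

The angle depends continuously on `d ≠ 1`, and the intermediate value theorem applies because of
the following facts.

* `θ_d(R) < π / 2` when `u` does not take the value `1` on `[0, R]`. This happens for `d` near
  `0`, by continuous dependence on `d`; for `d = R + 2`, since `|u'| < 1`; and for `d` near `1`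
  on either side, since `f'(1) = 0` makes the equation nearly trivial there
  (`exists_forall_near_one_ne_one`).
* For `R` large there are `d ∈ (0, 1)` and `d ∈ (1, R + 2)` with `θ_d(R) > k π`
  (`exists_lt_angle`). No fixed `d` will do: for a flat `f` and large `N` a given solution need
  not oscillate at all. Instead one looks at the phase points at a large radius `ρ = R - M`.
  Their energy `√(1 + y²) + ∫₁ᵘ f` depends continuously on `d`, so on either side of `d = 1` it
  takes the prescribed value `1 + c`, where `1` is its minimum. After `ρ` the damping `n / r` is
  weak, so on `[ρ, ρ + M]` the energy stays in a fixed shell, in which the undamped equation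
  rotates with angular velocity bounded below (`IsRestoring.exists_rotatesOnShell`,
  `IsProfile.lt_angle_of_energy_eq`). Both `M` and the shell are independent of `R`.

Hence each of the values `π, …, k π` is attained at least twice for `d < 1` and at least twice
for `d > 1`.

The initial value problem, singular at the origin, is solved as the fixed point of an integral
operator (`exists_profile_family`), written with the mean `∫₀¹ τⁿ f(u(rτ)) dτ`. This mean is
continuous up to `r = 0`, and the flux of `u(|x|)` is minus the mean times `x`. For the fixed
point `f` is extended by zero to the left and truncated on the right. The truncation is beyond
the reach of the solutions considered; the extension is harmless because a solution that becomes
nonpositive never satisfies the Neumann condition afterwards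
(`IsProfile.pos_of_momentum_eq_zero`).
-/

namespace LorentzMinkowski

open Filter Topology MeasureTheory
open scoped NNReal

/-! ### The Minkowski flux and the radial equation -/

/-- The inverse `p ↦ p / √(1 + p²)` of the Minkowski flux `s ↦ s / √(1 - s²)`. -/
noncomputable def slope (p : ℝ) : ℝ := p / Real.sqrt (1 + p ^ 2)

lemma sqrt_one_add_sq_pos (p : ℝ) : 0 < Real.sqrt (1 + p ^ 2) :=
  Real.sqrt_pos.2 (by positivity)

lemma hasDerivAt_sqrt_one_add_sq (p : ℝ) :
    HasDerivAt (fun p : ℝ => Real.sqrt (1 + p ^ 2)) (slope p) p := by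
  have h := ((hasDerivAt_pow 2 p).const_add 1).sqrt (by positivity)
  refine h.congr_deriv ?_
  have hpos := sqrt_one_add_sq_pos p
  simp only [slope]
  field_simp
  simp

lemma hasDerivAt_slope (p : ℝ) :
    HasDerivAt slope (1 / Real.sqrt (1 + p ^ 2) ^ 3) p := by
  have hpos := sqrt_one_add_sq_pos p
  have h := (hasDerivAt_id' p).div (hasDerivAt_sqrt_one_add_sq p) hpos.ne'
  have hs : Real.sqrt (1 + p ^ 2) ^ 2 = 1 + p ^ 2 := Real.sq_sqrt (by positivity)
  refine h.congr_deriv ?_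
  simp only [slope]
  field_simp
  linarith

@[fun_prop]
lemma continuous_slope : Continuous slope :=
  continuous_iff_continuousAt.2 fun p => (hasDerivAt_slope p).continuousAt

@[simp] lemma slope_zero : slope 0 = 0 := by simp [slope]

@[simp] lemma slope_neg (p : ℝ) : slope (-p) = -slope p := by simp [slope, neg_div]

lemma one_le_sqrt_one_add_sq (p : ℝ) : 1 ≤ Real.sqrt (1 + p ^ 2) :=
  Real.one_le_sqrt.2 (by nlinarith [sq_nonneg p])

lemma abs_slope_sub_le (p q : ℝ) : |slope p - slope q| ≤ |p - q| := by
  have h : LipschitzWith 1 slope := by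
    refine lipschitzWith_of_nnnorm_deriv_le (fun p => (hasDerivAt_slope p).differentiableAt) ?_
    intro p
    rw [(hasDerivAt_slope p).deriv, ← NNReal.coe_le_coe, coe_nnnorm, Real.norm_eq_abs,
      abs_of_nonneg (by positivity), NNReal.coe_one]
    exact div_le_one_of_le₀ (one_le_pow₀ (one_le_sqrt_one_add_sq p)) (by positivity)
  simpa [Real.dist_eq] using h.dist_le_mul p q

lemma abs_slope_le (p : ℝ) : |slope p| ≤ |p| := by
  simpa using abs_slope_sub_le p 0

lemma abs_slope_lt_one (p : ℝ) : |slope p| < 1 := by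
  rw [slope, abs_div, abs_of_pos (sqrt_one_add_sq_pos p), div_lt_one (sqrt_one_add_sq_pos p)]
  exact Real.lt_sqrt_of_sq_lt (by rw [sq_abs]; linarith)

lemma mul_slope_pos {p : ℝ} (hp : p ≠ 0) : 0 < p * slope p := by
  rw [slope, mul_div_assoc']
  exact div_pos (mul_self_pos.2 hp) (sqrt_one_add_sq_pos p)

lemma mul_slope_nonneg (p : ℝ) : 0 ≤ p * slope p := by
  rcases eq_or_ne p 0 with rfl | h
  · simp
  · exact (mul_slope_pos h).le

lemma mul_slope_le_sqrt (p : ℝ) : p * slope p ≤ Real.sqrt (1 + p ^ 2) := by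
  rw [slope, mul_div_assoc', div_le_iff₀ (sqrt_one_add_sq_pos p),
    Real.mul_self_sqrt (by positivity)]
  nlinarith

lemma slope_neg_of_neg {p : ℝ} (hp : p < 0) : slope p < 0 :=
  div_neg_of_neg_of_pos hp (sqrt_one_add_sq_pos p)

/-- The weighted mean `∫₀¹ τⁿ g(u(rτ)) dτ`, equal to `r⁻ⁿ⁻¹ ∫₀ʳ tⁿ g(u(t)) dt` for `r ≠ 0`. In this
form the singularity of the radial equation at the origin disappears. -/
noncomputable def mean (n : ℕ) (g u : ℝ → ℝ) (r : ℝ) : ℝ :=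
  ∫ τ in (0 : ℝ)..1, τ ^ n * g (u (r * τ))

lemma continuous_mean {X : Type*} [TopologicalSpace X] [FirstCountableTopology X] {n : ℕ}
    {g : ℝ → ℝ} (hg : Continuous g) {u : X → ℝ → ℝ} (hu : Continuous (Function.uncurry u)) :
    Continuous (fun p : X × ℝ => mean n g (u p.1) p.2) := by
  unfold mean
  refine intervalIntegral.continuous_parametric_intervalIntegral_of_continuous' ?_ 0 1
  have h1 : Continuous (fun q : (X × ℝ) × ℝ => u q.1.1 (q.1.2 * q.2)) :=
    hu.comp (g := Function.uncurry u) (f := fun q : (X × ℝ) × ℝ => (q.1.1, q.1.2 * q.2))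
      (by fun_prop)
  have h2 := hg.comp h1
  simp only [Function.uncurry_def, Function.comp_def] at h2 ⊢
  fun_prop

lemma continuous_mean_right {n : ℕ} {g u : ℝ → ℝ} (hg : Continuous g) (hu : Continuous u) :
    Continuous (mean n g u) := by
  have := continuous_mean (n := n) hg (X := Unit) (u := fun _ => u)
    (hu.comp continuous_snd)
  exact this.comp (f := fun r : ℝ => ((), r)) (by fun_prop)

lemma abs_mean_le {n : ℕ} {g u : ℝ → ℝ} {r C : ℝ}
    (h : ∀ τ ∈ Icc (0 : ℝ) 1, |g (u (r * τ))| ≤ C) : |mean n g u r| ≤ C := by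
  have := intervalIntegral.norm_integral_le_of_norm_le_const (a := 0) (b := 1) (C := C)
    (f := fun τ => τ ^ n * g (u (r * τ))) ?_
  · simpa [mean] using this
  · intro τ hτ
    rw [uIoc_of_le zero_le_one] at hτ
    have h1 := h τ ⟨hτ.1.le, hτ.2⟩
    rw [Real.norm_eq_abs, abs_mul, abs_of_nonneg (pow_nonneg hτ.1.le n)]
    have h2 : τ ^ n ≤ 1 := pow_le_one₀ hτ.1.le hτ.2
    nlinarith [abs_nonneg (g (u (r * τ))), pow_nonneg hτ.1.le n]

lemma pow_mul_mean (n : ℕ) (g u : ℝ → ℝ) (r : ℝ) :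
    r ^ (n + 1) * mean n g u r = ∫ t in (0 : ℝ)..r, t ^ n * g (u t) := by
  have h := intervalIntegral.mul_integral_comp_mul_left (a := 0) (b := 1) (c := r)
    (f := fun t => t ^ n * g (u t))
  simp only [mul_zero, mul_one] at h
  rw [← h, mean, pow_succ', mul_assoc, ← intervalIntegral.integral_const_mul]
  simp only [mul_pow, mul_assoc]

lemma mean_zero (n : ℕ) (g u : ℝ → ℝ) : mean n g u 0 = g (u 0) / (n + 1) := by
  simp [mean, integral_pow]
  ring

/-- The conservation law of the radial equation: `y(r) = -r · mean(r)` satisfies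
`y' = -g(u) - (n / r) y`, written without the singular quotient. -/
lemma hasDerivAt_neg_mul_mean {n : ℕ} {g u : ℝ → ℝ} (hg : Continuous g) (hu : Continuous u)
    (r : ℝ) : HasDerivAt (fun s => -(s * mean n g u s)) (-g (u r) + n * mean n g u r) r := by
  have hm := continuous_mean_right (n := n) hg hu
  rcases eq_or_ne r 0 with rfl | hr
  · have h : HasDerivAt (fun s => s * mean n g u s) (mean n g u 0) 0 := by
      rw [hasDerivAt_iff_tendsto_slope]
      have h1 : Tendsto (mean n g u) (𝓝[≠] 0) (𝓝 (mean n g u 0)) :=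
        hm.continuousAt.tendsto.mono_left nhdsWithin_le_nhds
      refine h1.congr' ?_
      filter_upwards [self_mem_nhdsWithin] with s hs
      have hs : s ≠ 0 := hs
      rw [slope_def_field]
      field_simp
      ring
    refine h.neg.congr_deriv ?_
    rw [mean_zero]
    field_simp
    ring
  · have hint : HasDerivAt (fun s => ∫ t in (0 : ℝ)..s, t ^ n * g (u t)) (r ^ n * g (u r)) r := by
      have hc : Continuous (fun t => t ^ n * g (u t)) := by fun_prop
      exact hc.integral_hasStrictDerivAt 0 r |>.hasDerivAt
    have h1 := hint.div (hasDerivAt_pow n r) (pow_ne_zero n hr)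
    refine (h1.neg.congr_of_eventuallyEq ?_).congr_deriv ?_
    · filter_upwards [isOpen_ne.mem_nhds hr] with s hs
      have hs : s ≠ 0 := hs
      simp only [Pi.neg_apply, Pi.div_apply]
      rw [← pow_mul_mean]
      field_simp
      ring
    · rw [← pow_mul_mean]
      have hrn : r ^ n ≠ 0 := pow_ne_zero n hr
      rcases n with _ | n
      · simp
      · simp only [Nat.add_sub_cancel]
        field_simp
        ring

/-- A radial profile: a `C¹` function `u` on the line with
`u(0) = d`, `u' = slope y` and `y = -r · mean(r)`. For `r ≥ 0` this says that `u(|x|)` solves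
`-div (∇u / √(1 - |∇u|²)) = g(u)` in dimension `n + 1`. -/
structure IsProfile (n : ℕ) (g : ℝ → ℝ) (d : ℝ) (u : ℝ → ℝ) : Prop where
  init : u 0 = d
  hasDerivAt : ∀ r, HasDerivAt u (slope (-(r * mean n g u r))) r

/-! ### Well-posedness of the profile equation -/

section Existence

variable {n : ℕ} {g : ℝ → ℝ} {L : ℝ≥0}

/-- The Picard map of the profile equation, conjugated by the weight `exp (κ r²)` so as to be a
contraction of the space of bounded continuous functions on the whole line. -/
noncomputable def picard (n : ℕ) (g : ℝ → ℝ) (κ d : ℝ) (z : ℝ → ℝ) (r : ℝ) : ℝ :=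
  Real.exp (-(κ * r ^ 2)) *
    (d + ∫ s in (0 : ℝ)..r, slope (-(s * mean n g (fun t => Real.exp (κ * t ^ 2) * z t) s)))

lemma continuous_picard (hg : Continuous g) (κ d : ℝ) {z : ℝ → ℝ} (hz : Continuous z) :
    Continuous (picard n g κ d z) := by
  have hm := continuous_mean_right (n := n) hg
    (u := fun t => Real.exp (κ * t ^ 2) * z t) (by fun_prop)
  have hs : Continuous (fun s => slope
      (-(s * mean n g (fun t => Real.exp (κ * t ^ 2) * z t) s))) := by fun_prop
  have h2 := intervalIntegral.continuous_primitive (μ := volume)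
    (fun a b => hs.intervalIntegrable a b) 0
  unfold picard
  fun_prop

lemma abs_picard_le {κ : ℝ} (hκ : 1 ≤ κ) (d : ℝ) (z : ℝ → ℝ) (r : ℝ) :
    |picard n g κ d z r| ≤ |d| + 1 := by
  have h1 : |∫ s in (0 : ℝ)..r,
      slope (-(s * mean n g (fun t => Real.exp (κ * t ^ 2) * z t) s))| ≤ |r| := by
    simpa using intervalIntegral.norm_integral_le_of_norm_le_const (a := 0) (b := r) (C := 1)
      (f := fun s => slope (-(s * mean n g (fun t => Real.exp (κ * t ^ 2) * z t) s)))
      fun s _ => (abs_slope_lt_one _).le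
  have h2 : 1 + κ * r ^ 2 ≤ Real.exp (κ * r ^ 2) := by
    linarith [Real.add_one_le_exp (κ * r ^ 2)]
  have h3 : Real.exp (-(κ * r ^ 2)) ≤ 1 := Real.exp_le_one_iff.2 (by nlinarith [sq_nonneg r])
  have h4 : |r| ≤ Real.exp (κ * r ^ 2) := by
    nlinarith [sq_abs r, sq_nonneg (|r| - 1), sq_nonneg r]
  have h5 : Real.exp (-(κ * r ^ 2)) * |r| ≤ 1 := by
    rw [Real.exp_neg, inv_mul_le_iff₀ (Real.exp_pos _)]
    simpa using h4
  rw [picard, abs_mul, abs_of_pos (Real.exp_pos _)]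
  calc _ ≤ Real.exp (-(κ * r ^ 2)) * (|d| + |r|) := by
        gcongr
        exact (abs_add_le _ _).trans (by gcongr)
    _ ≤ |d| + 1 := by nlinarith [abs_nonneg d]

/-- The Picard map halves distances once `κ ≥ L`: the factor `s` in front of the mean makes
`κ s exp (κ s²)`, half the derivative of the weight, a majorant of the integrand. -/
lemma abs_picard_sub_picard_le (hL : LipschitzWith L g) {κ : ℝ} (hκ : 0 < κ) (hκL : (L : ℝ) ≤ κ)
    (d : ℝ) {z₁ z₂ : ℝ → ℝ} (h₁ : Continuous z₁) (h₂ : Continuous z₂) {D : ℝ}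
    (hD : ∀ t, |z₁ t - z₂ t| ≤ D) (r : ℝ) :
    |picard n g κ d z₁ r - picard n g κ d z₂ r| ≤ 1 / 2 * D := by
  have hD0 : 0 ≤ D := (abs_nonneg _).trans (hD 0)
  have hg := hL.continuous
  set w₁ : ℝ → ℝ := fun t => Real.exp (κ * t ^ 2) * z₁ t with hw₁
  set w₂ : ℝ → ℝ := fun t => Real.exp (κ * t ^ 2) * z₂ t with hw₂
  have hw₁c : Continuous w₁ := by fun_prop
  have hw₂c : Continuous w₂ := by fun_prop
  have hm₁ := continuous_mean_right (n := n) hg hw₁c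
  have hm₂ := continuous_mean_right (n := n) hg hw₂c
  have hmean : ∀ s, |mean n g w₁ s - mean n g w₂ s| ≤ L * Real.exp (κ * s ^ 2) * D := by
    intro s
    have hc : ∀ w : ℝ → ℝ, Continuous w →
        IntervalIntegrable (fun τ => τ ^ n * g (w (s * τ))) volume 0 1 := fun w hw =>
      Continuous.intervalIntegrable (by fun_prop) _ _
    have h := intervalIntegral.norm_integral_le_of_norm_le_const (a := 0) (b := 1)
      (C := L * Real.exp (κ * s ^ 2) * D)
      (f := fun τ => τ ^ n * g (w₁ (s * τ)) - τ ^ n * g (w₂ (s * τ))) ?_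
    · rw [intervalIntegral.integral_sub (hc _ hw₁c) (hc _ hw₂c)] at h
      simpa [mean] using h
    · intro τ hτ
      rw [uIoc_of_le zero_le_one] at hτ
      have h1 := hL.dist_le_mul (w₁ (s * τ)) (w₂ (s * τ))
      rw [Real.dist_eq, Real.dist_eq, hw₁, hw₂] at h1
      simp only at h1
      rw [← mul_sub, abs_mul, abs_of_pos (Real.exp_pos _)] at h1
      have h2 : Real.exp (κ * (s * τ) ^ 2) ≤ Real.exp (κ * s ^ 2) := by
        apply Real.exp_le_exp.2
        have : τ ^ 2 ≤ 1 := pow_le_one₀ hτ.1.le hτ.2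
        rw [mul_pow]
        nlinarith [mul_nonneg hκ.le (sq_nonneg s)]
      have h3 : τ ^ n ≤ 1 := pow_le_one₀ hτ.1.le hτ.2
      rw [← mul_sub, Real.norm_eq_abs, abs_mul, abs_of_nonneg (pow_nonneg hτ.1.le n)]
      calc τ ^ n * |g (w₁ (s * τ)) - g (w₂ (s * τ))|
          ≤ 1 * (L * (Real.exp (κ * (s * τ) ^ 2) * |z₁ (s * τ) - z₂ (s * τ)|)) := by
            gcongr
        _ ≤ 1 * (L * (Real.exp (κ * s ^ 2) * D)) := by
            gcongr
            exact hD _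
        _ = _ := by ring
  have hcont : ∀ w : ℝ → ℝ, Continuous w → Continuous (fun s => slope (-(s * mean n g w s))) := by
    intro w hw
    have := continuous_mean_right (n := n) hg hw
    fun_prop
  -- Rescaling the integrals to `[0, 1]` treats both signs of `r` at once.
  have hscale : ∀ w : ℝ → ℝ, ∫ s in (0 : ℝ)..r, slope (-(s * mean n g w s)) =
      r * ∫ σ in (0 : ℝ)..1, slope (-((r * σ) * mean n g w (r * σ))) := by
    intro w
    have h := intervalIntegral.mul_integral_comp_mul_left (a := 0) (b := 1) (c := r)
      (f := fun s => slope (-(s * mean n g w s)))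
    simpa using h.symm
  have hcont' : ∀ w : ℝ → ℝ, Continuous w → IntervalIntegrable
      (fun σ => slope (-((r * σ) * mean n g w (r * σ)))) volume 0 1 := fun w hw =>
    ((hcont w hw).comp (continuous_const.mul continuous_id)).intervalIntegrable _ _
  have hint : |∫ σ in (0 : ℝ)..1, (slope (-((r * σ) * mean n g w₁ (r * σ))) -
      slope (-((r * σ) * mean n g w₂ (r * σ))))| ≤
      ∫ σ in (0 : ℝ)..1, |r| * σ * (κ * Real.exp (κ * (r * σ) ^ 2) * D) := by
    rw [← Real.norm_eq_abs]
    refine intervalIntegral.norm_integral_le_of_norm_le zero_le_one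
      (ae_of_all _ fun σ hσ => ?_) (Continuous.intervalIntegrable (by fun_prop) _ _)
    rw [Real.norm_eq_abs]
    refine (abs_slope_sub_le _ _).trans ?_
    rw [show -(r * σ * mean n g w₁ (r * σ)) - -(r * σ * mean n g w₂ (r * σ)) =
      -((r * σ) * (mean n g w₁ (r * σ) - mean n g w₂ (r * σ))) by ring, abs_neg, abs_mul, abs_mul,
      abs_of_pos hσ.1]
    have hσ0 := hσ.1.le
    gcongr
    refine (hmean _).trans ?_
    gcongr
  have hprim : |r| * ∫ σ in (0 : ℝ)..1, |r| * σ * (κ * Real.exp (κ * (r * σ) ^ 2) * D) =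
      D / 2 * (Real.exp (κ * r ^ 2) - 1) := by
    have hder : ∀ σ : ℝ, HasDerivAt (fun σ => D / 2 * Real.exp (κ * (r * σ) ^ 2))
        (|r| * (|r| * σ * (κ * Real.exp (κ * (r * σ) ^ 2) * D))) σ := by
      intro σ
      have h := ((((hasDerivAt_id σ).const_mul r).pow 2).const_mul κ).exp.const_mul (D / 2)
      refine h.congr_deriv ?_
      simp only [id, Nat.cast_ofNat, Nat.add_one_sub_one, pow_one, mul_one]
      have : |r| * |r| = r * r := abs_mul_abs_self r
      linear_combination (-(σ * κ * Real.exp (κ * (r * σ) ^ 2) * D)) * this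
    rw [← intervalIntegral.integral_const_mul, intervalIntegral.integral_eq_sub_of_hasDerivAt
      (fun σ _ => hder σ) (Continuous.intervalIntegrable (by fun_prop) _ _)]
    simp
    ring
  have hfin : |(∫ s in (0 : ℝ)..r, slope (-(s * mean n g w₁ s))) -
      ∫ s in (0 : ℝ)..r, slope (-(s * mean n g w₂ s))| ≤ D / 2 * Real.exp (κ * r ^ 2) := by
    rw [hscale, hscale, ← mul_sub, abs_mul, ← intervalIntegral.integral_sub (hcont' _ hw₁c)
      (hcont' _ hw₂c)]
    calc _ ≤ _ := mul_le_mul_of_nonneg_left hint (abs_nonneg r)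
      _ = _ := hprim
      _ ≤ _ := by nlinarith
  have hexp : picard n g κ d z₁ r - picard n g κ d z₂ r = Real.exp (-(κ * r ^ 2)) *
      ((∫ s in (0 : ℝ)..r, slope (-(s * mean n g w₁ s))) -
      ∫ s in (0 : ℝ)..r, slope (-(s * mean n g w₂ s))) := by
    simp only [picard, hw₁, hw₂]
    ring
  rw [hexp, abs_mul, abs_of_pos (Real.exp_pos _), Real.exp_neg, inv_mul_le_iff₀ (Real.exp_pos _)]
  linarith

/-- For Lipschitz `g` the profile equation is well posed on the whole line, with Lipschitz
dependence on the initial value, locally uniformly in `r`. -/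
theorem exists_profile_family (n : ℕ) {g : ℝ → ℝ} {L : ℝ≥0} (hL : LipschitzWith L g) :
    ∃ u : ℝ → ℝ → ℝ, (∀ d, IsProfile n g d (u d)) ∧
      (∀ d e r, |u d r - u e r| ≤ 2 * Real.exp ((L + 1) * r ^ 2) * |d - e|) ∧
      Continuous (Function.uncurry u) ∧ ∀ p, g p = 0 → ∀ r, u p r = p := by
  have hg := hL.continuous
  -- `κ ≥ 1` keeps the Picard iterates bounded, and `κ ≥ L` makes the Picard map a contraction.
  set κ : ℝ := L + 1 with hκ
  have hκ1 : 1 ≤ κ := by simp [hκ]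
  have hκL : (L : ℝ) ≤ κ := by simp [hκ]
  let T : ℝ → BoundedContinuousFunction ℝ ℝ → BoundedContinuousFunction ℝ ℝ := fun d z =>
    BoundedContinuousFunction.ofNormedAddCommGroup (picard n g κ d z)
      (continuous_picard hg κ d z.continuous) (|d| + 1) (abs_picard_le hκ1 d z)
  have hTdist : ∀ d z₁ z₂, dist (T d z₁) (T d z₂) ≤ 1 / 2 * dist z₁ z₂ := by
    intro d z₁ z₂
    refine (BoundedContinuousFunction.dist_le (by positivity)).2 fun r => ?_
    exact abs_picard_sub_picard_le hL (by linarith) hκL d z₁.continuous z₂.continuous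
      (fun t => by
        simpa only [Real.dist_eq] using
          BoundedContinuousFunction.dist_coe_le_dist (f := z₁) (g := z₂) t) r
  have hT : ∀ d, ContractingWith (1 / 2) (T d) := fun d =>
    ⟨by rw [← NNReal.coe_lt_coe]; norm_num,
      LipschitzWith.of_dist_le_mul fun z₁ z₂ => by simpa using hTdist d z₁ z₂⟩
  let z : ℝ → BoundedContinuousFunction ℝ ℝ := fun d => ContractingWith.fixedPoint (T d) (hT d)
  have hz : ∀ d, T d (z d) = z d := fun d => (hT d).fixedPoint_isFixedPt
  have hzLip : ∀ d e, dist (z d) (z e) ≤ 2 * |d - e| := by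
    intro d e
    have h1 : dist (T d (z e)) (T e (z e)) ≤ |d - e| := by
      refine (BoundedContinuousFunction.dist_le (abs_nonneg _)).2 fun r => ?_
      change |picard n g κ d (z e) r - picard n g κ e (z e) r| ≤ _
      simp only [picard]
      rw [← mul_sub, add_sub_add_right_eq_sub, abs_mul, abs_of_pos (Real.exp_pos _)]
      have h3 : Real.exp (-(κ * r ^ 2)) ≤ 1 :=
        Real.exp_le_one_iff.2 (by nlinarith [sq_nonneg r])
      nlinarith [abs_nonneg (d - e)]
    have h2 := dist_triangle (T d (z d)) (T d (z e)) (T e (z e))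
    have h3 := hTdist d (z d) (z e)
    have h4 : dist (z d) (z e) = dist (T d (z d)) (T e (z e)) := by rw [hz d, hz e]
    linarith
  have hzc : Continuous z :=
    (LipschitzWith.of_dist_le_mul (K := 2) fun d e => by
      simpa [Real.dist_eq] using hzLip d e).continuous
  refine ⟨fun d r => Real.exp (κ * r ^ 2) * z d r, fun d => ?_, fun d e r => ?_, ?_, ?_⟩
  · have huc : Continuous fun t => Real.exp (κ * t ^ 2) * z d t := by fun_prop
    have hform : ∀ r, Real.exp (κ * r ^ 2) * z d r = d + ∫ s in (0 : ℝ)..r,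
        slope (-(s * mean n g (fun t => Real.exp (κ * t ^ 2) * z d t) s)) := by
      intro r
      have h : picard n g κ d (z d) r = z d r := DFunLike.congr_fun (hz d) r
      rw [← h, picard, ← mul_assoc, ← Real.exp_add, add_neg_cancel, Real.exp_zero, one_mul]
    refine ⟨by simpa using hform 0, fun r => ?_⟩
    have hm := continuous_mean_right (n := n) hg huc
    have hs : Continuous (fun s => slope (-(s * mean n g
      (fun t => Real.exp (κ * t ^ 2) * z d t) s))) := by fun_prop
    have h := ((hs.integral_hasStrictDerivAt 0 r).hasDerivAt).const_add d
    exact h.congr_of_eventuallyEq (Eventually.of_forall hform)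
  · simp only
    rw [← mul_sub, abs_mul, abs_of_pos (Real.exp_pos _)]
    have h : |z d r - z e r| ≤ dist (z d) (z e) := by
      simpa only [Real.dist_eq] using
        BoundedContinuousFunction.dist_coe_le_dist (f := z d) (g := z e) r
    nlinarith [hzLip d e, Real.exp_pos (κ * r ^ 2)]
  · simp only [Function.uncurry_def]
    fun_prop
  · intro p hp r
    have hb : ∀ r : ℝ, |Real.exp (-(κ * r ^ 2)) * p| ≤ |p| := by
      intro r
      rw [abs_mul, abs_of_pos (Real.exp_pos _)]
      have h3 : Real.exp (-(κ * r ^ 2)) ≤ 1 :=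
        Real.exp_le_one_iff.2 (by nlinarith [sq_nonneg r])
      nlinarith [abs_nonneg p]
    let c : BoundedContinuousFunction ℝ ℝ := BoundedContinuousFunction.ofNormedAddCommGroup
      (fun r => Real.exp (-(κ * r ^ 2)) * p) (by fun_prop) |p| hb
    have hcexp : ∀ t : ℝ, Real.exp (κ * t ^ 2) * c t = p := by
      intro t
      change Real.exp (κ * t ^ 2) * (Real.exp (-(κ * t ^ 2)) * p) = p
      rw [← mul_assoc, ← Real.exp_add, add_neg_cancel, Real.exp_zero, one_mul]
    have hc : Function.IsFixedPt (T p) c := by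
      ext r
      change picard n g κ p c r = Real.exp (-(κ * r ^ 2)) * p
      simp [picard, hcexp, mean, hp]
    have : c = z p := (hT p).fixedPoint_unique hc
    simp only [← this]
    exact hcexp r

end Existence

/-! ### Profiles: uniqueness at equilibria and positivity -/

/-- The flux variable `y = u' / √(1 - u'²)` of a profile. -/
noncomputable def momentum (n : ℕ) (g u : ℝ → ℝ) (r : ℝ) : ℝ := -(r * mean n g u r)

@[simp] lemma momentum_zero (n : ℕ) (g u : ℝ → ℝ) : momentum n g u 0 = 0 := by simp [momentum]

/-- The sign structure of the nonlinearity, extended by zero to the negative half-line. -/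
structure IsRestoring (g : ℝ → ℝ) : Prop where
  nonpos : ∀ s ≤ 0, g s = 0
  neg : ∀ s, 0 < s → s < 1 → g s < 0
  one : g 1 = 0
  pos : ∀ s, 1 < s → 0 < g s

lemma IsRestoring.le_zero {g : ℝ → ℝ} (hg : IsRestoring g) {s : ℝ} (hs : s ≤ 1) : g s ≤ 0 := by
  rcases le_or_gt s 0 with h | h
  · exact (hg.nonpos s h).le
  · rcases hs.lt_or_eq with h1 | rfl
    · exact (hg.neg s h h1).le
    · exact hg.one.le

lemma IsRestoring.zero_le {g : ℝ → ℝ} (hg : IsRestoring g) {s : ℝ} (hs : 1 ≤ s) : 0 ≤ g s := by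
  rcases hs.lt_or_eq with h1 | rfl
  · exact (hg.pos s h1).le
  · exact hg.one.ge

namespace IsProfile

variable {n : ℕ} {g u : ℝ → ℝ} {d : ℝ} {L : ℝ≥0}

lemma continuous (hu : IsProfile n g d u) : Continuous u :=
  continuous_iff_continuousAt.2 fun r => (hu.hasDerivAt r).continuousAt

lemma continuous_mean (hu : IsProfile n g d u) (hg : Continuous g) : Continuous (mean n g u) :=
  continuous_mean_right hg hu.continuous

lemma continuous_momentum (hu : IsProfile n g d u) (hg : Continuous g) :
    Continuous (momentum n g u) := by
  have := hu.continuous_mean hg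
  unfold momentum
  fun_prop

lemma hasDerivAt_momentum (hu : IsProfile n g d u) (hg : Continuous g) (r : ℝ) :
    HasDerivAt (momentum n g u) (-g (u r) + n * mean n g u r) r :=
  hasDerivAt_neg_mul_mean hg hu.continuous r

lemma abs_sub_le (hu : IsProfile n g d u) (r s : ℝ) : |u r - u s| ≤ |r - s| := by
  have h : LipschitzWith 1 u := by
    refine lipschitzWith_of_nnnorm_deriv_le (fun p => (hu.hasDerivAt p).differentiableAt) ?_
    intro p
    rw [(hu.hasDerivAt p).deriv, ← NNReal.coe_le_coe, coe_nnnorm, Real.norm_eq_abs]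
    exact (abs_slope_lt_one _).le
  simpa [Real.dist_eq] using h.dist_le_mul r s

lemma abs_sub_init_le (hu : IsProfile n g d u) (r : ℝ) : |u r - d| ≤ |r| := by
  simpa [hu.init] using hu.abs_sub_le r 0

lemma mean_comp_neg (r : ℝ) : mean n g (fun t => u (-t)) r = mean n g u (-r) := by
  simp [mean]

lemma comp_neg (hu : IsProfile n g d u) : IsProfile n g d (fun r => u (-r)) := by
  refine ⟨by simpa using hu.init, fun r => ?_⟩
  refine ((hu.hasDerivAt (-r)).scomp r (hasDerivAt_neg r)).congr_deriv ?_
  simp [mean_comp_neg]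

/-- On `(0, ∞)` a profile cannot reach an equilibrium of the phase plane. The weight `exp (C r)`
is Gronwall's, run backwards from the time `r`; its rate degenerates at the origin. -/
lemma phase_pos_of_pos (hu : IsProfile n g d u) (hL : LipschitzWith L g) {p : ℝ} (hp : g p = 0)
    (hd : d ≠ p) {r : ℝ} (hr : 0 < r) : 0 < (u r - p) ^ 2 + momentum n g u r ^ 2 := by
  have hg := hL.continuous
  set E : ℝ → ℝ := fun r => (u r - p) ^ 2 + momentum n g u r ^ 2 with hE
  have hE0 : ∀ r, 0 ≤ E r := fun r => by positivity
  have hEder : ∀ s, HasDerivAt E (2 * (u s - p) * slope (momentum n g u s) +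
      2 * momentum n g u s * (-g (u s) + n * mean n g u s)) s := by
    intro s
    refine (((hu.hasDerivAt s).sub_const p).pow 2 |>.add
      ((hu.hasDerivAt_momentum hg s).pow 2)).congr_deriv ?_
    simp [momentum]
  by_contra hcon
  have hEr : E r = 0 := le_antisymm (not_lt.1 hcon) (hE0 r)
  have hzero : ∀ ε ∈ Ioc 0 r, E ε = 0 := by
    intro ε hε
    set C : ℝ := 1 + L + 2 * n / ε with hC
    have hmono : MonotoneOn (fun s => E s * Real.exp (C * s)) (Icc ε r) := by
      have hder : ∀ s, HasDerivAt (fun s => E s * Real.exp (C * s)) _ s := fun s =>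
        (hEder s).mul (((hasDerivAt_id' s).const_mul C).exp)
      refine monotoneOn_of_hasDerivWithinAt_nonneg (convex_Icc _ _)
        (fun s _ => (hder s).continuousAt.continuousWithinAt)
        (fun s _ => (hder s).hasDerivWithinAt) fun s hs => ?_
      rw [interior_Icc] at hs
      have hs0 : 0 < s := hε.1.trans hs.1
      set x := u s - p
      set y := momentum n g u s with hy
      have h1 : |g (u s)| ≤ L * |x| := by
        have := hL.dist_le_mul (u s) p
        simpa [Real.dist_eq, hp] using this
      have h2 : mean n g u s = -(y / s) := by
        rw [hy, momentum]
        field_simp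
      have h3 : -(x * slope y) ≤ |x| * |y| := by
        calc _ ≤ |x * slope y| := neg_le_abs _
          _ = |x| * |slope y| := abs_mul _ _
          _ ≤ _ := mul_le_mul_of_nonneg_left (abs_slope_le y) (abs_nonneg x)
      have h4 : y * g (u s) ≤ L * (|x| * |y|) := by
        calc _ ≤ |y * g (u s)| := le_abs_self _
          _ = |y| * |g (u s)| := abs_mul _ _
          _ ≤ |y| * (L * |x|) := by gcongr
          _ = _ := by ring
      have h5 : 2 * (|x| * |y|) ≤ E s := by
        have := two_mul_le_add_sq |x| |y|
        rw [sq_abs, sq_abs] at this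
        simp only [hE]
        linarith
      have h6 : n * (y * (y / s)) ≤ n / ε * E s := by
        have : y * (y / s) ≤ E s / ε := by
          rw [← mul_div_assoc, div_le_div_iff₀ hs0 hε.1]
          have : y * y ≤ E s := by simp only [hE]; nlinarith [sq_nonneg (u s - p)]
          nlinarith [mul_self_nonneg y, hs.1, hE0 s, hε.1]
        calc _ ≤ n * (E s / ε) := by gcongr
          _ = _ := by ring
      have h7 : 0 ≤ (2 * x * slope y + 2 * y * (-g (u s) + n * mean n g u s)) + C * E s := by
        have h8 : L * (2 * (|x| * |y|)) ≤ L * E s := by gcongr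
        have h9 : C * E s = E s + L * E s + 2 * (n / ε * E s) := by rw [hC]; ring
        rw [h2, h9]
        nlinarith
      have := mul_nonneg h7 (Real.exp_pos (C * s)).le
      calc (0 : ℝ) ≤ _ := this
        _ = _ := by ring
    have := hmono (left_mem_Icc.2 hε.2) (right_mem_Icc.2 hε.2) hε.2
    simp only [hEr, zero_mul] at this
    exact le_antisymm (nonpos_of_mul_nonpos_left this (Real.exp_pos _)) (hE0 ε)
  have hlim : Tendsto E (𝓝[>] 0) (𝓝 (E 0)) :=
    (hEder 0).continuousAt.tendsto.mono_left nhdsWithin_le_nhds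
  have hlim' : Tendsto E (𝓝[>] 0) (𝓝 0) := by
    refine tendsto_const_nhds.congr' ?_
    filter_upwards [Ioc_mem_nhdsGT hr] with s hs using (hzero s hs).symm
  have h0 : E 0 = 0 := tendsto_nhds_unique hlim hlim'
  simp only [hE, momentum_zero, hu.init] at h0
  exact hd (by nlinarith [sq_nonneg (d - p)])

/-- A profile that does not start at an equilibrium `(p, 0)` of the phase plane never reaches it. -/
lemma phase_pos (hu : IsProfile n g d u) (hL : LipschitzWith L g) {p : ℝ} (hp : g p = 0)
    (hd : d ≠ p) (r : ℝ) : 0 < (u r - p) ^ 2 + momentum n g u r ^ 2 := by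
  rcases lt_trichotomy r 0 with h | rfl | h
  · have := hu.comp_neg.phase_pos_of_pos hL hp hd (neg_pos.2 h)
    simpa [momentum, mean_comp_neg] using this
  · have : d - p ≠ 0 := sub_ne_zero.2 hd
    simp only [hu.init, momentum_zero]
    positivity
  · exact hu.phase_pos_of_pos hL hp hd h

end IsProfile

/-- The first time at which a continuous function that starts negative becomes zero. -/
lemma exists_first_zero {h : ℝ → ℝ} (hc : Continuous h) {a b : ℝ} (hab : a ≤ b) (ha : h a < 0)
    (hb : 0 ≤ h b) : ∃ c ∈ Ioc a b, h c = 0 ∧ ∀ s ∈ Ico a c, h s < 0 := by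
  set S : Set ℝ := Icc a b ∩ {s | 0 ≤ h s} with hS
  have hcomp : IsCompact S := isCompact_Icc.inter_right (isClosed_le continuous_const hc)
  obtain ⟨c, hc1, hc2⟩ := hcomp.exists_isLeast ⟨b, ⟨right_mem_Icc.2 hab, hb⟩⟩
  have hneg : ∀ s ∈ Ico a c, h s < 0 := by
    intro s hs
    by_contra hcon
    exact absurd (hc2 ⟨⟨hs.1, hs.2.le.trans hc1.1.2⟩, not_lt.1 hcon⟩) (not_le.2 hs.2)
  have hac : a < c := lt_of_le_of_ne hc1.1.1 (by rintro rfl; exact absurd hc1.2 (not_le.2 ha))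
  refine ⟨c, ⟨hac, hc1.1.2⟩, le_antisymm ?_ hc1.2, hneg⟩
  have hlim : Tendsto h (𝓝[<] c) (𝓝 (h c)) := hc.continuousAt.tendsto.mono_left nhdsWithin_le_nhds
  refine le_of_tendsto hlim ?_
  filter_upwards [Ico_mem_nhdsLT hac] with s hs using (hneg s hs).le

namespace IsProfile

variable {n : ℕ} {g u : ℝ → ℝ} {d : ℝ} {L : ℝ≥0}

/-- A profile satisfying the Neumann condition at `R` is positive up to `R`: if it reached zero, it
would do so with negative slope, and since `g` vanishes on the negative half-line nothing would make
it turn back. -/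
lemma pos_of_momentum_eq_zero (hu : IsProfile n g d u) (hL : LipschitzWith L g)
    (hg : IsRestoring g) (hd : 0 < d) {R : ℝ} (hR : momentum n g u R = 0) {r : ℝ}
    (hr : r ∈ Icc 0 R) : 0 < u r := by
  by_contra hcon
  have hgc := hL.continuous
  obtain ⟨a, ha, hua, hpre⟩ := exists_first_zero (h := fun s => -u s) hu.continuous.neg hr.1
    (by simpa [hu.init] using hd) (by simpa using hcon)
  have hua : u a = 0 := by simpa using hua
  -- The slope at the first zero is nonpositive, and nonzero by uniqueness.
  have hya : momentum n g u a < 0 := by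
    have hne : momentum n g u a ≠ 0 := by
      intro h0
      have := hu.phase_pos hL (hg.nonpos 0 le_rfl) hd.ne' a
      rw [hua, h0] at this
      simp at this
    refine lt_of_le_of_ne ?_ hne
    by_contra hpos
    have hs : 0 < slope (momentum n g u a) := by
      rw [slope]
      exact div_pos (not_le.1 hpos) (sqrt_one_add_sq_pos _)
    have hev : ∀ᶠ s in 𝓝[<] a, 0 < _root_.slope u a s := by
      have h1 := hasDerivAt_iff_tendsto_slope.1 (hu.hasDerivAt a)
      exact (h1.mono_left (nhdsWithin_mono _ fun s hs => ne_of_lt hs)).eventually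
        (lt_mem_nhds hs)
    obtain ⟨s, hs1, hs2⟩ := (hev.and (Ico_mem_nhdsLT ha.1)).exists
    rw [slope_def_field, hua] at hs1
    have h2 := hpre s hs2
    have h3 : s - a < 0 := sub_neg.2 hs2.2
    have : (u s - 0) / (s - a) < 0 := div_neg_of_pos_of_neg (by linarith) h3
    linarith
  obtain ⟨b, hb, hyb, hpost⟩ := exists_first_zero (hu.continuous_momentum hgc)
    (ha.2.trans hr.2) hya hR.ge
  have hub : ∀ s ∈ Icc a b, u s ≤ 0 := by
    have hanti : AntitoneOn u (Icc a b) := by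
      refine antitoneOn_of_hasDerivWithinAt_nonpos (convex_Icc _ _) hu.continuous.continuousOn
        (fun s _ => (hu.hasDerivAt s).hasDerivWithinAt) fun s hs => ?_
      rw [interior_Icc] at hs
      exact (slope_neg_of_neg (hpost s ⟨hs.1.le, hs.2⟩)).le
    intro s hs
    have := hanti (left_mem_Icc.2 hb.1.le) hs hs.1
    rwa [hua] at this
  -- There `y' = -(n / r) y`, so that `y` cannot return to zero.
  have hanti : AntitoneOn (fun s => momentum n g u s * Real.exp (n / a * s)) (Icc a b) := by
    have hder : ∀ s, HasDerivAt (fun s => momentum n g u s * Real.exp (n / a * s)) _ s := fun s =>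
      (hu.hasDerivAt_momentum hgc s).mul (((hasDerivAt_id' s).const_mul (n / a : ℝ)).exp)
    refine antitoneOn_of_hasDerivWithinAt_nonpos (convex_Icc _ _)
      (fun s _ => (hder s).continuousAt.continuousWithinAt)
      (fun s _ => (hder s).hasDerivWithinAt) fun s hs => ?_
    rw [interior_Icc] at hs
    have hs0 : 0 < s := ha.1.trans hs.1
    have hys := hpost s ⟨hs.1.le, hs.2⟩
    have h2 : mean n g u s = -(momentum n g u s / s) := by
      rw [momentum]
      field_simp
    rw [hg.nonpos _ (hub s ⟨hs.1.le, hs.2.le⟩), h2]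
    have h3 : (n : ℝ) / s ≤ n / a := div_le_div_of_nonneg_left (by positivity) ha.1 hs.1.le
    have h4 : momentum n g u s * (n / a - n / s) ≤ 0 :=
      mul_nonpos_of_nonpos_of_nonneg hys.le (by linarith)
    have := mul_nonpos_of_nonpos_of_nonneg h4 (Real.exp_pos (n / a * s)).le
    calc _ = momentum n g u s * (n / a - n / s) * Real.exp (n / a * s) := by ring
      _ ≤ 0 := this
  have h := hanti (left_mem_Icc.2 hb.1.le) (right_mem_Icc.2 hb.1.le) hb.1.le
  simp only [hyb, zero_mul] at h
  have := mul_neg_of_neg_of_pos hya (Real.exp_pos (n / a * a))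
  linarith

end IsProfile

/-! ### The phase angle -/

/-- The clockwise angular velocity of `(u - 1, y)` around the origin. -/
noncomputable def angularVelocity (n : ℕ) (g u : ℝ → ℝ) (r : ℝ) : ℝ :=
  ((u r - 1) * (g (u r) - n * mean n g u r) + momentum n g u r * slope (momentum n g u r)) /
    ((u r - 1) ^ 2 + momentum n g u r ^ 2)

/-- The clockwise angle swept by `(u - 1, y)` around the origin on `[0, r]`. -/
noncomputable def angle (n : ℕ) (g u : ℝ → ℝ) (r : ℝ) : ℝ :=
  ∫ s in (0 : ℝ)..r, angularVelocity n g u s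

@[simp] lemma angle_zero (n : ℕ) (g u : ℝ → ℝ) : angle n g u 0 = 0 := by simp [angle]

namespace IsProfile

variable {n : ℕ} {g u : ℝ → ℝ} {d : ℝ} {L : ℝ≥0}

lemma continuous_angularVelocity (hu : IsProfile n g d u) (hL : LipschitzWith L g)
    (h1 : g 1 = 0) (hd : d ≠ 1) : Continuous (angularVelocity n g u) := by
  have hg := hL.continuous
  have := hu.continuous
  have := hu.continuous_mean hg
  have := hu.continuous_momentum hg
  exact Continuous.div (by fun_prop) (by fun_prop) fun r => (hu.phase_pos hL h1 hd r).ne'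

lemma hasDerivAt_angle (hu : IsProfile n g d u) (hL : LipschitzWith L g)
    (h1 : g 1 = 0) (hd : d ≠ 1) (r : ℝ) :
    HasDerivAt (angle n g u) (angularVelocity n g u r) r :=
  ((hu.continuous_angularVelocity hL h1 hd).integral_hasStrictDerivAt 0 r).hasDerivAt

/-- The angle is a polar angle: `(u - 1, y)` is a multiple of `(cos θ, -sin θ)`. -/
lemma sin_angle_add_cos_angle (hu : IsProfile n g d u) (hL : LipschitzWith L g)
    (h1 : g 1 = 0) (hd : d ≠ 1) (r : ℝ) :
    (u r - 1) * Real.sin (angle n g u r) + momentum n g u r * Real.cos (angle n g u r) = 0 := by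
  have hg := hL.continuous
  set B : ℝ → ℝ := fun r =>
    (u r - 1) * Real.sin (angle n g u r) + momentum n g u r * Real.cos (angle n g u r) with hB
  set E : ℝ → ℝ := fun r => (u r - 1) ^ 2 + momentum n g u r ^ 2 with hE
  have hEpos : ∀ r, 0 < E r := fun r => hu.phase_pos hL h1 hd r
  -- `B² / E` is the squared sine of the defect of the angle; it is constant.
  have hder : ∀ r, HasDerivAt (fun r => B r ^ 2 / E r) 0 r := by
    intro r
    have hx := (hu.hasDerivAt r).sub_const 1
    have hy := hu.hasDerivAt_momentum hg r
    have hθ := hu.hasDerivAt_angle hL h1 hd r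
    have hBd := (hx.mul hθ.sin).add (hy.mul hθ.cos)
    have hEd := (hx.pow 2).add (hy.pow 2)
    have hω : angularVelocity n g u r * E r = (u r - 1) * (g (u r) - n * mean n g u r) +
        momentum n g u r * slope (momentum n g u r) := div_mul_cancel₀ _ (hEpos r).ne'
    refine ((hBd.pow 2).div hEd (hEpos r).ne').congr_deriv ?_
    rw [div_eq_zero_iff]
    left
    have hm : -(r * mean n g u r) = momentum n g u r := rfl
    simp only [Pi.add_apply, Pi.mul_apply, Pi.pow_apply, Nat.cast_ofNat, Nat.add_one_sub_one,
      pow_one, hm]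
    simp only [hE] at hω
    set θ := angle n g u r
    set ω := angularVelocity n g u r
    set x := u r - 1
    set y := momentum n g u r
    set b := x * Real.sin θ + y * Real.cos θ with hb
    have key : (slope y * Real.sin θ + x * (Real.cos θ * ω) +
        ((-g (u r) + n * mean n g u r) * Real.cos θ + y * (-Real.sin θ * ω))) * (x ^ 2 + y ^ 2) =
        b * (x * slope y + y * (-g (u r) + n * mean n g u r)) := by
      rw [hb]
      linear_combination (x * Real.cos θ - y * Real.sin θ) * hω
    linear_combination 2 * b * key
  have hconst := is_const_of_deriv_eq_zero (fun r => (hder r).differentiableAt)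
    (fun r => (hder r).deriv) r 0
  have h0 : B 0 = 0 := by simp [hB]
  simp only [h0, ne_eq, OfNat.ofNat_ne_zero, not_false_eq_true, zero_pow, zero_div] at hconst
  simpa [(hEpos r).ne'] using hconst

lemma cos_angle_eq_zero_iff (hu : IsProfile n g d u) (hL : LipschitzWith L g)
    (h1 : g 1 = 0) (hd : d ≠ 1) (r : ℝ) : Real.cos (angle n g u r) = 0 ↔ u r - 1 = 0 := by
  have h := hu.sin_angle_add_cos_angle hL h1 hd r
  constructor
  · intro hc
    have hs : Real.sin (angle n g u r) ≠ 0 := by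
      intro hs
      have := Real.sin_sq_add_cos_sq (angle n g u r)
      simp [hs, hc] at this
    rw [hc, mul_zero, add_zero] at h
    exact (mul_eq_zero.1 h).resolve_right hs
  · intro hx
    have hE := hu.phase_pos hL h1 hd r
    rw [hx, zero_mul, zero_add] at h
    refine (mul_eq_zero.1 h).resolve_left fun hy => ?_
    simp [hx, hy] at hE

lemma momentum_eq_zero_of_angle (hu : IsProfile n g d u) (hL : LipschitzWith L g)
    (h1 : g 1 = 0) (hd : d ≠ 1) {r : ℝ} {j : ℕ} (hj : angle n g u r = j * Real.pi) :
    momentum n g u r = 0 := by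
  have h := hu.sin_angle_add_cos_angle hL h1 hd r
  have hs : Real.sin (angle n g u r) = 0 := by rw [hj, Real.sin_nat_mul_pi]
  have hc : Real.cos (angle n g u r) ≠ 0 := by
    intro hc
    have := Real.sin_sq_add_cos_sq (angle n g u r)
    simp [hs, hc] at this
  rw [hs, mul_zero, zero_add] at h
  exact (mul_eq_zero.1 h).resolve_right hc

/-- The vertical axis `u = 1` is only crossed clockwise. -/
lemma angularVelocity_pos_of_cos_eq_zero (hu : IsProfile n g d u) (hL : LipschitzWith L g)
    (h1 : g 1 = 0) (hd : d ≠ 1) {r : ℝ} (hr : Real.cos (angle n g u r) = 0) :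
    0 < angularVelocity n g u r := by
  have hx := (hu.cos_angle_eq_zero_iff hL h1 hd r).1 hr
  have hE := hu.phase_pos hL h1 hd r
  refine div_pos ?_ hE
  rw [hx, zero_mul, zero_add]
  refine mul_slope_pos fun hy => ?_
  simp [hx, hy] at hE

end IsProfile

/-- A function whose derivative is positive on the level `ℓ` crosses that level upwards only. -/
lemma lt_of_le_of_deriv_pos_on_level {θ ω : ℝ → ℝ} (hθ : ∀ r, HasDerivAt θ (ω r) r) {ℓ : ℝ}
    (hℓ : ∀ r, θ r = ℓ → 0 < ω r) {a b : ℝ} (hab : a < b) (ha : ℓ ≤ θ a) : ℓ < θ b := by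
  have hge : ∀ x ∈ Icc a b, ℓ ≤ θ x := fun x hx =>
    image_le_of_deriv_right_lt_deriv_boundary (f := fun _ => ℓ) (f' := fun _ => 0)
      continuousOn_const (fun x _ => hasDerivWithinAt_const _ _ _) ha hθ
      (fun x _ h => hℓ x h.symm) hx
  refine lt_of_le_of_ne (hge b (right_mem_Icc.2 hab.le)) fun heq => ?_
  have hev : ∀ᶠ s in 𝓝[<] b, 0 < _root_.slope θ b s := by
    have h1 := hasDerivAt_iff_tendsto_slope.1 (hθ b)
    exact (h1.mono_left (nhdsWithin_mono _ fun s hs => ne_of_lt hs)).eventually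
      (lt_mem_nhds (hℓ b heq.symm))
  obtain ⟨s, hs1, hs2⟩ := (hev.and (Ico_mem_nhdsLT hab)).exists
  rw [slope_def_field] at hs1
  have h2 := hge s ⟨hs2.1, hs2.2.le⟩
  have : (θ s - θ b) / (s - b) ≤ 0 :=
    div_nonpos_of_nonneg_of_nonpos (by linarith) (by linarith [hs2.2])
  linarith

/-- An angle that crosses the odd multiples of `π / 2` upwards only and goes from `0` to `j π`
meets them exactly `j` times. -/
lemma encard_cos_eq_zero {θ ω : ℝ → ℝ} (hθ : ∀ r, HasDerivAt θ (ω r) r) (h0 : θ 0 = 0)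
    (hpos : ∀ r, Real.cos (θ r) = 0 → 0 < ω r) {R : ℝ} (hR : 0 < R) {j : ℕ}
    (hj : θ R = j * Real.pi) : {r ∈ Ioo 0 R | Real.cos (θ r) = 0}.encard = j := by
  have hπ := Real.pi_pos
  have hc : Continuous θ := continuous_iff_continuousAt.2 fun r => (hθ r).continuousAt
  have hlevel : ∀ i : ℤ, ∀ r, θ r = (2 * i + 1) * Real.pi / 2 → 0 < ω r := fun i r h =>
    hpos r (Real.cos_eq_zero_iff.2 ⟨i, h⟩)
  have hex : ∀ i : ℕ, i < j → ∃ r ∈ Ioo 0 R, θ r = (2 * i + 1) * Real.pi / 2 := by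
    intro i hi
    have hi' : (i : ℝ) + 1 ≤ j := by exact_mod_cast hi
    refine intermediate_value_Ioo hR.le hc.continuousOn ⟨?_, ?_⟩
    · rw [h0]; positivity
    · rw [hj]; nlinarith
  choose! z hz hzθ using hex
  have hset : {r ∈ Ioo 0 R | Real.cos (θ r) = 0} = z '' (Finset.range j : Set ℕ) := by
    ext r
    constructor
    · rintro ⟨hr, hcos⟩
      obtain ⟨i, hi⟩ := Real.cos_eq_zero_iff.1 hcos
      have hi0 : 0 ≤ i := by
        by_contra hneg
        have hi1 : (i : ℝ) + 1 ≤ 0 := by exact_mod_cast not_le.1 hneg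
        have := lt_of_le_of_deriv_pos_on_level hθ (hlevel i) hr.1 (by rw [h0]; nlinarith)
        linarith
      lift i to ℕ using hi0
      have hij : i < j := by
        by_contra hge
        have hi1 : (j : ℝ) ≤ i := by exact_mod_cast not_lt.1 hge
        have := lt_of_le_of_deriv_pos_on_level hθ (hlevel i) hr.2 hi.ge
        rw [hj] at this
        push_cast at this
        nlinarith
      refine ⟨i, by simpa using hij, ?_⟩
      have hzi := hzθ i hij
      push_cast at hi
      rcases lt_trichotomy (z i) r with h | h | h
      · have := lt_of_le_of_deriv_pos_on_level hθ (hlevel i) h (by push_cast; exact hzi.ge)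
        push_cast at this
        linarith
      · exact h
      · have := lt_of_le_of_deriv_pos_on_level hθ (hlevel i) h (by push_cast; exact hi.ge)
        push_cast at this
        linarith
    · rintro ⟨i, hi, rfl⟩
      have hij : i < j := by simpa using hi
      exact ⟨hz i hij, Real.cos_eq_zero_iff.2 ⟨i, by simpa using hzθ i hij⟩⟩
  have hinj : InjOn z (Finset.range j : Set ℕ) := by
    intro a ha b hb hab
    have h1 := hzθ a (by simpa using ha)
    have h2 := hzθ b (by simpa using hb)
    rw [hab, h2] at h1
    have h3 : ((b : ℝ) - a) * Real.pi = 0 := by linarith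
    have h4 : (b : ℝ) - a = 0 := (mul_eq_zero.1 h3).resolve_right hπ.ne'
    exact_mod_cast (sub_eq_zero.1 h4).symm
  rw [hset, hinj.encard_image, Set.encard_coe_eq_coe_finsetCard, Finset.card_range]

/-- Without crossings of the vertical axis the angle stays below `π / 2`. -/
lemma lt_pi_div_two_of_cos_ne_zero {θ : ℝ → ℝ} (hc : Continuous θ) (h0 : θ 0 = 0) {R : ℝ}
    (hR : 0 ≤ R) (h : ∀ r ∈ Icc 0 R, Real.cos (θ r) ≠ 0) : θ R < Real.pi / 2 := by
  by_contra hcon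
  obtain ⟨r, hr, hθ⟩ := intermediate_value_Icc hR hc.continuousOn
    (show Real.pi / 2 ∈ Icc (θ 0) (θ R) from ⟨by rw [h0]; positivity, not_lt.1 hcon⟩)
  exact h r hr (by rw [hθ, Real.cos_pi_div_two])

/-! ### Energy and fast rotation -/

/-- The potential `∫₁ˢ g`. -/
noncomputable def potential (g : ℝ → ℝ) (s : ℝ) : ℝ := ∫ t in (1 : ℝ)..s, g t

@[simp] lemma potential_one (g : ℝ → ℝ) : potential g 1 = 0 := by simp [potential]

lemma hasDerivAt_potential {g : ℝ → ℝ} (hg : Continuous g) (s : ℝ) :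
    HasDerivAt (potential g) (g s) s :=
  (hg.integral_hasStrictDerivAt 1 s).hasDerivAt

lemma continuous_potential {g : ℝ → ℝ} (hg : Continuous g) : Continuous (potential g) :=
  continuous_iff_continuousAt.2 fun s => (hasDerivAt_potential hg s).continuousAt

namespace IsRestoring

variable {g : ℝ → ℝ}

lemma antitoneOn_potential (hg : IsRestoring g) (hc : Continuous g) :
    AntitoneOn (potential g) (Iic 1) := by
  refine antitoneOn_of_hasDerivWithinAt_nonpos (convex_Iic _)
    (continuous_potential hc).continuousOn
    (fun s _ => (hasDerivAt_potential hc s).hasDerivWithinAt) fun s hs => ?_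
  rw [interior_Iic] at hs
  exact hg.le_zero (le_of_lt hs)

lemma monotoneOn_potential (hg : IsRestoring g) (hc : Continuous g) :
    MonotoneOn (potential g) (Ici 1) := by
  refine monotoneOn_of_hasDerivWithinAt_nonneg (convex_Ici _)
    (continuous_potential hc).continuousOn
    (fun s _ => (hasDerivAt_potential hc s).hasDerivWithinAt) fun s hs => ?_
  rw [interior_Ici] at hs
  exact hg.zero_le (le_of_lt hs)

lemma potential_nonneg (hg : IsRestoring g) (hc : Continuous g) (s : ℝ) : 0 ≤ potential g s := by
  rw [← potential_one g]
  rcases le_total s 1 with h | h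
  · exact hg.antitoneOn_potential hc h self_mem_Iic h
  · exact hg.monotoneOn_potential hc self_mem_Ici h h

lemma potential_zero_pos (hg : IsRestoring g) (hc : Continuous g) : 0 < potential g 0 := by
  rw [potential, intervalIntegral.integral_symm, ← intervalIntegral.integral_neg]
  exact intervalIntegral.intervalIntegral_pos_of_pos_on (hc.neg.intervalIntegrable _ _)
    (fun s hs => neg_pos.2 (hg.neg s hs.1 hs.2)) one_pos

lemma potential_two_pos (hg : IsRestoring g) (hc : Continuous g) : 0 < potential g 2 :=
  intervalIntegral.intervalIntegral_pos_of_pos_on (hc.intervalIntegrable _ _)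
    (fun s hs => hg.pos s hs.1) one_lt_two

/-- The sublevel sets of the potential below its values at `0` and `2` lie in `(0, 2)`. -/
lemma mem_Ioo_of_potential_le (hg : IsRestoring g) (hc : Continuous g) {c s : ℝ}
    (h0 : c < potential g 0) (h2 : c < potential g 2) (hs : potential g s ≤ c) :
    s ∈ Ioo 0 2 := by
  constructor
  · by_contra hcon
    have := hg.antitoneOn_potential hc (mem_Iic.2 ((not_lt.1 hcon).trans zero_le_one))
      (mem_Iic.2 zero_le_one) (not_lt.1 hcon)
    linarith
  · by_contra hcon
    have := hg.monotoneOn_potential hc (mem_Ici.2 one_le_two)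
      (mem_Ici.2 (one_le_two.trans (not_lt.1 hcon))) (not_lt.1 hcon)
    linarith

end IsRestoring

/-- On the closed energy shell `1 + c / 2 ≤ √(1 + y²) + ∫₁ˢ g ≤ 1 + c` of the phase plane, which
surrounds `(1, 0)` inside the strip `0 < s < 2`, the undamped equation rotates around `(1, 0)` with
angular velocity at least `ω`. -/
structure RotatesOnShell (g : ℝ → ℝ) (c ω : ℝ) : Prop where
  lt_potential_zero : c < potential g 0
  lt_potential_two : c < potential g 2
  le_rotation : ∀ s y : ℝ, 1 + c / 2 ≤ Real.sqrt (1 + y ^ 2) + potential g s →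
    Real.sqrt (1 + y ^ 2) + potential g s ≤ 1 + c →
    ω * ((s - 1) ^ 2 + y ^ 2) ≤ (s - 1) * g s + y * slope y

lemma IsRestoring.exists_rotatesOnShell {g : ℝ → ℝ} (hg : IsRestoring g) (hc : Continuous g) :
    ∃ c > 0, ∃ ω > 0, RotatesOnShell g c ω := by
  have h0 := hg.potential_zero_pos hc
  have h2 := hg.potential_two_pos hc
  set c := min (potential g 0) (potential g 2) / 2 with hcdef
  have hcpos : 0 < c := by positivity
  have hc0 : c < potential g 0 := by
    have := min_le_left (potential g 0) (potential g 2)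
    linarith
  have hc2 : c < potential g 2 := by
    have := min_le_right (potential g 0) (potential g 2)
    linarith
  have hpot := continuous_potential hc
  set K : Set (ℝ × ℝ) := (Icc 0 2 ×ˢ Icc (-(1 + c)) (1 + c)) ∩
    {p | 1 + c / 2 ≤ Real.sqrt (1 + p.2 ^ 2) + potential g p.1 ∧
      Real.sqrt (1 + p.2 ^ 2) + potential g p.1 ≤ 1 + c} with hK
  have hmem : ∀ s y : ℝ, 1 + c / 2 ≤ Real.sqrt (1 + y ^ 2) + potential g s →
      Real.sqrt (1 + y ^ 2) + potential g s ≤ 1 + c → s ∈ Ioo 0 2 ∧ (s, y) ∈ K := by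
    intro s y hl hr
    have hs : s ∈ Ioo (0 : ℝ) 2 := hg.mem_Ioo_of_potential_le hc hc0 hc2
      (by linarith [one_le_sqrt_one_add_sq y])
    have hy : |y| ≤ 1 + c := by
      have h3 : |y| ≤ Real.sqrt (1 + y ^ 2) :=
        Real.le_sqrt_of_sq_le (by rw [sq_abs]; linarith)
      linarith [hg.potential_nonneg hc s]
    exact ⟨hs, ⟨⟨⟨hs.1.le, hs.2.le⟩, abs_le.1 hy⟩, hl, hr⟩⟩
  have hcomp : IsCompact K := by
    have hH : Continuous (fun p : ℝ × ℝ => Real.sqrt (1 + p.2 ^ 2) + potential g p.1) := by fun_prop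
    exact (isCompact_Icc.prod isCompact_Icc).inter_right
      ((isClosed_le continuous_const hH).inter (isClosed_le hH continuous_const))
  have hne : ∀ p ∈ K, 0 < (p.1 - 1) ^ 2 + p.2 ^ 2 := by
    rintro ⟨s, y⟩ hp
    by_contra hcon
    have hsy : (s - 1) ^ 2 + y ^ 2 ≤ 0 := not_lt.1 hcon
    have hs : s = 1 := by nlinarith [sq_nonneg (s - 1), sq_nonneg y]
    have hy : y = 0 := by nlinarith [sq_nonneg (s - 1), sq_nonneg y]
    have := hp.2.1
    simp [hs, hy] at this
    linarith
  have hpos : ∀ p ∈ K, 0 < ((p.1 - 1) * g p.1 + p.2 * slope p.2) /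
      ((p.1 - 1) ^ 2 + p.2 ^ 2) := by
    rintro ⟨s, y⟩ hp
    refine div_pos ?_ (hne _ hp)
    have hs := (hmem s y hp.2.1 hp.2.2).1
    simp only
    have hsg : 0 ≤ (s - 1) * g s := by
      rcases le_total s 1 with h | h
      · exact mul_nonneg_of_nonpos_of_nonpos (by linarith) (hg.le_zero h)
      · exact mul_nonneg (by linarith) (hg.zero_le h)
    rcases eq_or_ne y 0 with rfl | hy
    · have hs1 : s ≠ 1 := by
        rintro rfl
        have := hne _ hp
        simp at this
      rw [zero_mul, add_zero]
      rcases lt_or_gt_of_ne hs1 with h | h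
      · exact mul_pos_of_neg_of_neg (by linarith) (hg.neg s hs.1 h)
      · exact mul_pos (by linarith) (hg.pos s h)
    · linarith [mul_slope_pos hy]
  have hcont : ContinuousOn (fun p : ℝ × ℝ => ((p.1 - 1) * g p.1 + p.2 * slope p.2) /
      ((p.1 - 1) ^ 2 + p.2 ^ 2)) K := by
    refine ContinuousOn.div (Continuous.continuousOn ?_) (Continuous.continuousOn (by fun_prop))
      fun p hp => (hne p hp).ne'
    fun_prop
  obtain ⟨ω, hω, hle⟩ := hcomp.exists_forall_le' hcont hpos
  refine ⟨c, hcpos, ω, hω, hc0, hc2, fun s y hl hr => ?_⟩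
  have hp := (hmem s y hl hr).2
  exact (le_div_iff₀ (hne _ hp)).1 (hle _ hp)

/-- The rotation rate on the shell depends only on the values of the nonlinearity up to `2`. -/
lemma RotatesOnShell.congr {g G : ℝ → ℝ} {c ω : ℝ} (hG : RotatesOnShell G c ω)
    (hg : IsRestoring g) (hc : Continuous g) (h : EqOn g G (Iic 2)) : RotatesOnShell g c ω := by
  have hpot : ∀ s ≤ 2, potential g s = potential G s := by
    intro s hs
    refine intervalIntegral.integral_congr fun t ht => h ?_
    exact (ht.2.trans (max_le one_le_two hs) : t ≤ 2)
  have h0 : c < potential g 0 := by rw [hpot 0 zero_le_two]; exact hG.lt_potential_zero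
  have h2 : c < potential g 2 := by rw [hpot 2 le_rfl]; exact hG.lt_potential_two
  refine ⟨h0, h2, fun s y hl hr => ?_⟩
  have hs := hg.mem_Ioo_of_potential_le hc h0 h2 (s := s)
    (by linarith [one_le_sqrt_one_add_sq y])
  rw [hpot s hs.2.le] at hl hr
  rw [h (mem_Iic.2 hs.2.le)]
  exact hG.le_rotation s y hl hr

/-- The energy `√(1 + y²) + ∫₁ᵘ g` of a profile, where `√(1 + y²) = 1 / √(1 - u'²)`. -/
noncomputable def energy (n : ℕ) (g u : ℝ → ℝ) (r : ℝ) : ℝ :=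
  Real.sqrt (1 + momentum n g u r ^ 2) + potential g (u r)

namespace IsProfile

variable {n : ℕ} {g u : ℝ → ℝ} {d : ℝ} {L : ℝ≥0}

lemma mean_eq {r : ℝ} (hr : r ≠ 0) : mean n g u r = -(momentum n g u r / r) := by
  rw [momentum]
  field_simp

lemma hasDerivAt_energy (hu : IsProfile n g d u) (hg : Continuous g) {r : ℝ} (hr : r ≠ 0) :
    HasDerivAt (energy n g u) (-(n / r * (momentum n g u r * slope (momentum n g u r)))) r := by
  have h1 := (hasDerivAt_sqrt_one_add_sq (momentum n g u r)).comp r (hu.hasDerivAt_momentum hg r)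
  have h2 := (hasDerivAt_potential hg (u r)).comp r (hu.hasDerivAt r)
  refine (h1.add h2).congr_deriv ?_
  have hm : -(r * mean n g u r) = momentum n g u r := rfl
  rw [hm, mean_eq hr]
  ring

lemma continuous_energy (hu : IsProfile n g d u) (hg : Continuous g) :
    Continuous (energy n g u) := by
  have := hu.continuous
  have := hu.continuous_momentum hg
  have := continuous_potential hg
  unfold energy
  fun_prop

lemma antitoneOn_energy (hu : IsProfile n g d u) (hg : Continuous g) :
    AntitoneOn (energy n g u) (Ici 0) := by
  refine antitoneOn_of_hasDerivWithinAt_nonpos (convex_Ici _)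
    (hu.continuous_energy hg).continuousOn (f' := fun r =>
      -(n / r * (momentum n g u r * slope (momentum n g u r)))) (fun s hs => ?_) fun s hs => ?_
  all_goals
    rw [interior_Ici] at hs
    have hs : 0 < s := hs
  · exact (hu.hasDerivAt_energy hg hs.ne').hasDerivWithinAt
  · have := mul_slope_nonneg (momentum n g u s)
    exact neg_nonpos.2 (by positivity)

/-- Far from the origin the damping is weak: the relative loss of energy on `[ρ, b]` is at most
`n (b - ρ) / ρ`. -/
lemma le_energy (hu : IsProfile n g d u) (hr : IsRestoring g) (hg : Continuous g) {ρ b : ℝ}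
    (hρ : 0 < ρ) (hb : ρ ≤ b) :
    energy n g u ρ - n / ρ * energy n g u ρ * (b - ρ) ≤ energy n g u b := by
  have hmono : MonotoneOn (fun s => energy n g u s + n / ρ * energy n g u ρ * s) (Icc ρ b) := by
    refine monotoneOn_of_hasDerivWithinAt_nonneg (convex_Icc _ _)
      ((hu.continuous_energy hg).add (continuous_const.mul continuous_id)).continuousOn
      (f' := fun s => -(n / s * (momentum n g u s * slope (momentum n g u s))) +
        n / ρ * energy n g u ρ * 1) (fun s hs => ?_) fun s hs => ?_
    all_goals
      rw [interior_Icc] at hs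
      have hs0 : 0 < s := hρ.trans hs.1
    · exact ((hu.hasDerivAt_energy hg hs0.ne').add
        ((hasDerivAt_id' s).const_mul _)).hasDerivWithinAt
    · have h1 : momentum n g u s * slope (momentum n g u s) ≤ energy n g u ρ := by
        have h2 := mul_slope_le_sqrt (momentum n g u s)
        have h3 := hu.antitoneOn_energy hg (mem_Ici.2 hρ.le) (mem_Ici.2 hs0.le) hs.1.le
        have h4 := hr.potential_nonneg hg (u s)
        simp only [energy] at h3 ⊢
        linarith
      have h5 : (n : ℝ) / s ≤ n / ρ := div_le_div_of_nonneg_left (by positivity) hρ hs.1.le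
      have h6 := mul_le_mul h5 h1 (mul_slope_nonneg _) (by positivity)
      linarith
  have := hmono (left_mem_Icc.2 hb) (right_mem_Icc.2 hb) hb
  simp only at this
  linarith

lemma neg_pi_div_two_lt_angle (hu : IsProfile n g d u) (hL : LipschitzWith L g)
    (h1 : g 1 = 0) (hd : d ≠ 1) {r : ℝ} (hr : 0 < r) : -(Real.pi / 2) < angle n g u r := by
  refine lt_of_le_of_deriv_pos_on_level (hu.hasDerivAt_angle hL h1 hd) (fun s hs => ?_) hr ?_
  · refine hu.angularVelocity_pos_of_cos_eq_zero hL h1 hd ?_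
    rw [hs, Real.cos_neg, Real.cos_pi_div_two]
  · rw [angle_zero]
    linarith [Real.pi_pos]

/-- A profile that lies on the shell at a large radius `ρ` stays in it on `[ρ, ρ + M]` and
rotates there. -/
lemma lt_angle_of_energy_eq (hu : IsProfile n g d u) (hL : LipschitzWith L g)
    (hr : IsRestoring g) (hd : d ≠ 1) {c ω ρ M : ℝ} (hs : RotatesOnShell g c ω) (hc : 0 < c)
    (hρ : 0 < ρ) (hM : 0 ≤ M) (hloss : n / ρ * (1 + c) * M ≤ c / 2) (hdamp : n / ρ ≤ ω)
    (hE : energy n g u ρ = 1 + c) :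
    ω / 2 * M - Real.pi / 2 < angle n g u (ρ + M) := by
  have hg := hL.continuous
  have hvel : ∀ r ∈ Icc ρ (ρ + M), ω / 2 ≤ angularVelocity n g u r := by
    intro r hrm
    have hr0 : 0 < r := hρ.trans_le hrm.1
    have hpos := hu.phase_pos hL hr.one hd r
    have hup : energy n g u r ≤ 1 + c := by
      rw [← hE]
      exact hu.antitoneOn_energy hg (mem_Ici.2 hρ.le) (mem_Ici.2 hr0.le) hrm.1
    have hlow : 1 + c / 2 ≤ energy n g u r := by
      have h1 := hu.le_energy hr hg hρ hrm.1
      rw [hE] at h1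
      have h2 : n / ρ * (1 + c) * (r - ρ) ≤ n / ρ * (1 + c) * M := by
        gcongr
        linarith [hrm.2]
      linarith
    have hrot := hs.le_rotation (u r) (momentum n g u r) hlow hup
    rw [angularVelocity, le_div_iff₀ hpos, mean_eq hr0.ne']
    set x := u r - 1
    set y := momentum n g u r
    have h3 : -(n / ρ * (x ^ 2 + y ^ 2)) ≤ 2 * (x * (n * (y / r))) := by
      have h4 : (n : ℝ) / r ≤ n / ρ := div_le_div_of_nonneg_left (by positivity) hρ hrm.1
      have h5 : 0 ≤ (n : ℝ) / r := by positivity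
      calc -(n / ρ * (x ^ 2 + y ^ 2)) ≤ -(n / r * (x ^ 2 + y ^ 2)) := by
            have := mul_le_mul_of_nonneg_right h4 hpos.le
            linarith
        _ ≤ n / r * (2 * (x * y)) := by nlinarith [mul_nonneg h5 (sq_nonneg (x + y))]
        _ = _ := by ring
    have h6 := mul_le_mul_of_nonneg_right hdamp hpos.le
    linarith
  have hmono : MonotoneOn (fun s => angle n g u s - ω / 2 * s) (Icc ρ (ρ + M)) := by
    have hder : ∀ s, HasDerivAt (fun s => angle n g u s - ω / 2 * s)
        (angularVelocity n g u s - ω / 2 * 1) s := fun s =>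
      (hu.hasDerivAt_angle hL hr.one hd s).sub ((hasDerivAt_id' s).const_mul _)
    refine monotoneOn_of_hasDerivWithinAt_nonneg (convex_Icc _ _)
      (fun s _ => (hder s).continuousAt.continuousWithinAt)
      (fun s _ => (hder s).hasDerivWithinAt) fun s hs => ?_
    have := hvel s (interior_subset hs)
    linarith
  have h := hmono (left_mem_Icc.2 (by linarith)) (right_mem_Icc.2 (by linarith))
    (by linarith : ρ ≤ ρ + M)
  have h0 := hu.neg_pi_div_two_lt_angle hL hr.one hd hρ
  simp only at h
  linarith

end IsProfile

/-! ### Dependence of the angle on the initial value -/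

section Family

variable {n : ℕ} {g : ℝ → ℝ} {L : ℝ≥0} {u : ℝ → ℝ → ℝ}

lemma continuous_momentum_family (hg : Continuous g) (hc : Continuous (Function.uncurry u)) :
    Continuous (fun p : ℝ × ℝ => momentum n g (u p.1) p.2) := by
  have := continuous_mean (n := n) hg hc
  unfold momentum
  fun_prop

lemma continuous_energy_family (hg : Continuous g) (hc : Continuous (Function.uncurry u)) (r : ℝ) :
    Continuous (fun d => energy n g (u d) r) := by
  have h1 : Continuous (fun d => momentum n g (u d) r) :=
    (continuous_momentum_family (n := n) hg hc).comp (f := fun d : ℝ => (d, r)) (by fun_prop)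
  have h2 : Continuous (fun d => u d r) := hc.comp (f := fun d : ℝ => (d, r)) (by fun_prop)
  have := continuous_potential hg
  unfold energy
  fun_prop

lemma continuousOn_angle_family (hu : ∀ d, IsProfile n g d (u d)) (hL : LipschitzWith L g)
    (hc : Continuous (Function.uncurry u)) (h1 : g 1 = 0) (R : ℝ) :
    ContinuousOn (fun d => angle n g (u d) R) {d | d ≠ 1} := by
  have hg := hL.continuous
  rw [continuousOn_iff_continuous_domRestrict]
  refine intervalIntegral.continuous_parametric_intervalIntegral_of_continuous'
    (f := fun (d : {d : ℝ // d ≠ 1}) r => angularVelocity n g (u d) r) ?_ 0 R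
  have hφ : Continuous (fun q : {d : ℝ // d ≠ 1} × ℝ => ((q.1 : ℝ), q.2)) := by fun_prop
  have hm := (continuous_mean (n := n) hg hc).comp hφ
  have hy := (continuous_momentum_family (n := n) hg hc).comp hφ
  have hx : Continuous (fun q : {d : ℝ // d ≠ 1} × ℝ => u q.1 q.2) := hc.comp hφ
  simp only [Function.comp_def] at hm hy
  exact Continuous.div (by fun_prop) (by fun_prop) fun q => ((hu q.1).phase_pos hL h1 q.1.2 q.2).ne'

/-- Profiles that do not cross the value `1` sweep an angle less than `π / 2`. -/
lemma angle_lt_of_ne_one {d : ℝ} {v : ℝ → ℝ} (hv : IsProfile n g d v) (hL : LipschitzWith L g)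
    (h1 : g 1 = 0) (hd : d ≠ 1) {R : ℝ} (hR : 0 ≤ R) (h : ∀ r ∈ Icc 0 R, v r ≠ 1) :
    angle n g v R < Real.pi / 2 := by
  refine lt_pi_div_two_of_cos_ne_zero ?_ (angle_zero _ _ _) hR fun r hr hcos => ?_
  · exact continuous_iff_continuousAt.2 fun r => (hv.hasDerivAt_angle hL h1 hd r).continuousAt
  · exact h r hr (sub_eq_zero.1 ((hv.cos_angle_eq_zero_iff hL h1 hd r).1 hcos))

/-- Since `g'(1) = 0`, profiles that start close enough to `1` stay on one side of it up to `R`. -/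
lemma exists_forall_near_one_ne_one (hu : ∀ d, IsProfile n g d (u d))
    (hlip : ∀ d e r, |u d r - u e r| ≤ 2 * Real.exp ((L + 1) * r ^ 2) * |d - e|)
    (hone : ∀ r, u 1 r = 1) (h1 : g 1 = 0) (hg1 : HasDerivAt g 0 1) {R : ℝ} (hR : 0 < R) :
    ∃ δ > 0, ∀ d, d ≠ 1 → |d - 1| < δ → ∀ r ∈ Icc 0 R, u d r ≠ 1 := by
  -- The bound `|g(s)| ≤ ε |s - 1|` moves `u` by at most `R² ε` times its deviation from `1`.
  set ε : ℝ := 1 / (4 * R ^ 2) with hε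
  have hεpos : 0 < ε := by positivity
  have hsmall : ∀ᶠ s in 𝓝 (1 : ℝ), |g s| ≤ ε * |s - 1| := by
    have := (hasDerivAt_iff_isLittleO.1 hg1).def hεpos
    simpa [h1] using this
  obtain ⟨η, hη, hgη⟩ := Metric.eventually_nhds_iff.1 hsmall
  set A : ℝ := 2 * Real.exp ((L + 1) * R ^ 2) with hA
  have hApos : 0 < A := by positivity
  refine ⟨η / A, by positivity, fun d hd hdδ => ?_⟩
  have hclose : ∀ r ∈ Icc 0 R, |u d r - 1| < η := by
    intro r hr
    have h2 := hlip d 1 r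
    rw [hone] at h2
    have h3 : Real.exp ((L + 1) * r ^ 2) ≤ Real.exp ((L + 1) * R ^ 2) := by
      apply Real.exp_le_exp.2
      have h4 := hr.1
      have h5 := hr.2
      gcongr
    calc |u d r - 1| ≤ _ := h2
      _ ≤ A * |d - 1| := by rw [hA]; gcongr
      _ < η := by rwa [lt_div_iff₀' hApos] at hdδ
  -- The largest deviation `X` from `1` is comparable to `|d - 1|`, while `u` moves by at most
  -- `X / 4`.
  obtain ⟨r₀, hr₀, hmax⟩ := isCompact_Icc.exists_isMaxOn (nonempty_Icc.2 hR.le)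
    (((hu d).continuous.sub continuous_const).abs.continuousOn (s := Icc 0 R)
      (f := fun r => |u d r - 1|))
  set X : ℝ := |u d r₀ - 1| with hX
  have hXmax : ∀ r ∈ Icc 0 R, |u d r - 1| ≤ X := fun r hr => hmax hr
  have hmean : ∀ r ∈ Icc 0 R, |mean n g (u d) r| ≤ ε * X := by
    intro r hr
    refine abs_mean_le fun τ hτ => ?_
    have hmem : r * τ ∈ Icc 0 R :=
      ⟨mul_nonneg hr.1 hτ.1, (mul_le_of_le_one_right hr.1 hτ.2).trans hr.2⟩
    refine (hgη (by simpa [Real.dist_eq] using hclose _ hmem)).trans ?_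
    gcongr
    exact hXmax _ hmem
  have hdev : ∀ r ∈ Icc 0 R, |u d r - d| ≤ X / 4 := by
    intro r hr
    have hbound := (convex_Icc 0 R).norm_image_sub_le_of_norm_hasDerivWithin_le (𝕜 := ℝ)
      (f := u d) (C := R * (ε * X)) (x := 0) (y := r)
      (fun s _ => ((hu d).hasDerivAt s).hasDerivWithinAt) ?_ (left_mem_Icc.2 hR.le) hr
    · rw [(hu d).init, Real.norm_eq_abs, Real.norm_eq_abs, sub_zero, abs_of_nonneg hr.1] at hbound
      calc _ ≤ R * (ε * X) * r := hbound
        _ ≤ R * (ε * X) * R := by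
          have := hr.2
          gcongr
        _ = X / 4 := by rw [hε]; field_simp
    · intro s hs
      rw [Real.norm_eq_abs]
      refine (abs_slope_le _).trans ?_
      rw [abs_neg, abs_mul, abs_of_nonneg hs.1]
      have := hs.2
      have := hmean s hs
      gcongr
  have hXd : X ≤ |d - 1| + X / 4 := by
    have h2 := hdev r₀ hr₀
    calc X = |(u d r₀ - d) + (d - 1)| := by rw [hX]; ring_nf
      _ ≤ |u d r₀ - d| + |d - 1| := abs_add_le _ _
      _ ≤ _ := by linarith
  intro r hr heq
  have h3 := hdev r hr
  rw [heq, abs_sub_comm] at h3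
  have h4 : 0 < |d - 1| := abs_pos.2 (sub_ne_zero.2 hd)
  linarith

/-- Profiles that start close enough to `0` stay below `1` up to `R`. -/
lemma exists_forall_near_zero_ne_one
    (hlip : ∀ d e r, |u d r - u e r| ≤ 2 * Real.exp ((L + 1) * r ^ 2) * |d - e|)
    (hzero : ∀ r, u 0 r = 0) (R : ℝ) :
    ∃ δ > 0, ∀ d, |d| < δ → ∀ r ∈ Icc 0 R, u d r ≠ 1 := by
  set A : ℝ := 2 * Real.exp ((L + 1) * R ^ 2) with hA
  have hApos : 0 < A := by positivity
  refine ⟨1 / A, by positivity, fun d hd r hr heq => ?_⟩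
  have h2 := hlip d 0 r
  rw [hzero, heq, sub_zero, sub_zero, abs_one] at h2
  have h3 : Real.exp ((L + 1) * r ^ 2) ≤ Real.exp ((L + 1) * R ^ 2) := by
    apply Real.exp_le_exp.2
    have h4 := hr.1
    have h5 := hr.2
    gcongr
  have h4 : (1 : ℝ) ≤ A * |d| := by
    rw [hA]
    refine h2.trans ?_
    gcongr
  rw [lt_div_iff₀' hApos] at hd
  linarith

/-- Along the curve of phase points at a fixed radius `ρ`, the energy takes the value `1 + c` both
for some initial value in `(0, 1)` and for one in `(1, ρ + 2)`; these profiles rotate a lot on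
`[ρ, ρ + M]`. -/
lemma exists_lt_angle (hu : ∀ d, IsProfile n g d (u d)) (hL : LipschitzWith L g)
    (hc : Continuous (Function.uncurry u)) (hr : IsRestoring g)
    (hone : ∀ r, u 1 r = 1) (hzero : ∀ r, u 0 r = 0) {c ω ρ M : ℝ} (hs : RotatesOnShell g c ω)
    (hcpos : 0 < c) (hρ : 0 < ρ) (hM : 0 ≤ M) (hloss : n / ρ * (1 + c) * M ≤ c / 2)
    (hdamp : n / ρ ≤ ω) :
    (∃ d ∈ Ioo 0 1, ω / 2 * M - Real.pi / 2 < angle n g (u d) (ρ + M)) ∧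
      ∃ d ∈ Ioo 1 (ρ + 2), ω / 2 * M - Real.pi / 2 < angle n g (u d) (ρ + M) := by
  have hg := hL.continuous
  have hH := continuous_energy_family (n := n) hg hc ρ
  have hH1 : energy n g (u 1) ρ = 1 := by
    simp [energy, momentum, mean, hone, hr.one]
  have hH0 : energy n g (u 0) ρ = 1 + potential g 0 := by
    simp [energy, momentum, mean, hzero, hr.nonpos 0 le_rfl]
  have hH2 : 1 + c < energy n g (u (ρ + 2)) ρ := by
    have h2 : 2 ≤ u (ρ + 2) ρ := by
      have := (abs_le.1 ((hu (ρ + 2)).abs_sub_init_le ρ)).1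
      rw [abs_of_pos hρ] at this
      linarith
    have h3 := hr.monotoneOn_potential hg (mem_Ici.2 one_le_two)
      (mem_Ici.2 (one_le_two.trans h2)) h2
    have h4 := one_le_sqrt_one_add_sq (momentum n g (u (ρ + 2)) ρ)
    have h5 := hs.lt_potential_two
    simp only [energy]
    linarith
  constructor
  · obtain ⟨d, hd, hE⟩ := intermediate_value_Ioo' (zero_le_one' ℝ) hH.continuousOn
      (show 1 + c ∈ Ioo _ _ from
        ⟨by rw [hH1]; linarith, by rw [hH0]; linarith [hs.lt_potential_zero]⟩)
    exact ⟨d, hd, (hu d).lt_angle_of_energy_eq hL hr hd.2.ne hs hcpos hρ hM hloss hdamp hE⟩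
  · obtain ⟨d, hd, hE⟩ := intermediate_value_Ioo (by linarith : (1 : ℝ) ≤ ρ + 2) hH.continuousOn
      (show 1 + c ∈ Ioo _ _ from ⟨by rw [hH1]; linarith, hH2⟩)
    exact ⟨d, hd, (hu d).lt_angle_of_energy_eq hL hr hd.1.ne' hs hcpos hρ hM hloss hdamp hE⟩

end Family

/-! ### From profiles to radial solutions on the ball -/

section RadialField

variable {V : Type*} [NormedAddCommGroup V] [InnerProductSpace ℝ V]

lemma hasFDerivAt_norm_of_ne_zero {x : V} (hx : x ≠ 0) :
    HasFDerivAt (fun z : V => ‖z‖) (‖x‖⁻¹ • innerSL ℝ x) x := by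
  have hx' : 0 < ‖x‖ := norm_pos_iff.2 hx
  have h := (hasStrictFDerivAt_norm_sq x).hasFDerivAt.sqrt (pow_pos hx' 2).ne'
  have h2 : (fun z : V => Real.sqrt (‖z‖ ^ 2)) = fun z => ‖z‖ := by
    ext z
    exact Real.sqrt_sq (norm_nonneg z)
  rw [h2] at h
  refine h.congr_fderiv ?_
  rw [Real.sqrt_sq hx'.le]
  ext v
  simp
  field_simp

/-- The derivative of the radial vector field `x ↦ m(|x|) x` when `r m'(r) = κ(r)`: at the origin,
where `κ(0) = 0`, only the first term remains, because `0⁻¹ = 0`. -/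
noncomputable def radialFieldDeriv (m κ : ℝ → ℝ) (x : V) : V →L[ℝ] V :=
  m ‖x‖ • ContinuousLinearMap.id ℝ V +
    (κ ‖x‖ * (‖x‖ ^ 2)⁻¹) • (innerSL ℝ x).smulRight x

lemma hasFDerivAt_radialField {m κ : ℝ → ℝ} (hm : Continuous m)
    (hder : ∀ r, 0 < r → HasDerivAt m (κ r / r) r) (x : V) :
    HasFDerivAt (fun z : V => m ‖z‖ • z) (radialFieldDeriv m κ x) x := by
  rcases eq_or_ne x 0 with rfl | hx
  · rw [hasFDerivAt_iff_isLittleO_nhds_zero]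
    have h1 : (fun h : V => m ‖h‖ - m 0) =o[𝓝 0] fun _ => (1 : ℝ) := by
      rw [Asymptotics.isLittleO_one_iff]
      have : Continuous (fun h : V => m ‖h‖ - m 0) := by fun_prop
      simpa using this.tendsto 0
    have h2 := h1.smul_isBigO (Asymptotics.isBigO_refl (fun h : V => h) (𝓝 0))
    simpa [radialFieldDeriv, sub_smul] using h2
  · have hx' : 0 < ‖x‖ := norm_pos_iff.2 hx
    have h1 := (hder ‖x‖ hx').comp_hasFDerivAt x (hasFDerivAt_norm_of_ne_zero hx)
    refine (h1.smul (hasFDerivAt_id x)).congr_fderiv ?_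
    ext v
    simp [radialFieldDeriv, smul_smul]
    field_simp

lemma continuous_radialFieldDeriv {m κ : ℝ → ℝ} (hm : Continuous m) (hκ : Continuous κ)
    (hκ0 : κ 0 = 0) : Continuous (radialFieldDeriv m κ : V → V →L[ℝ] V) := by
  refine Continuous.add (by fun_prop) ?_
  have hS : Continuous (fun x : V => (innerSL ℝ x).smulRight x) := by fun_prop
  rw [continuous_iff_continuousAt]
  intro x
  rcases eq_or_ne x 0 with rfl | hx
  · rw [ContinuousAt]
    have hlim : Tendsto (fun x : V => |κ ‖x‖|) (𝓝 0) (𝓝 0) := by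
      have : Continuous (fun x : V => |κ ‖x‖|) := by fun_prop
      simpa [hκ0] using this.tendsto 0
    simp only [norm_zero, hκ0, zero_mul, zero_smul]
    refine squeeze_zero_norm (fun x => ?_) hlim
    rw [norm_smul, ContinuousLinearMap.norm_smulRight_apply, innerSL_apply_norm, norm_mul,
      Real.norm_eq_abs, norm_inv, norm_pow, norm_norm, mul_assoc, ← pow_two]
    rcases eq_or_ne x 0 with rfl | hx
    · simp
    · rw [inv_mul_cancel₀ (pow_ne_zero 2 (norm_ne_zero_iff.2 hx)), mul_one]
  · have hx' : ‖x‖ ^ 2 ≠ 0 := pow_ne_zero 2 (norm_ne_zero_iff.2 hx)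
    have h1 : ContinuousAt (fun x : V => κ ‖x‖ * (‖x‖ ^ 2)⁻¹) x := by
      refine ContinuousAt.mul (by fun_prop) (ContinuousAt.inv₀ (by fun_prop) hx')
    exact h1.smul hS.continuousAt

lemma contDiff_radialField {m κ : ℝ → ℝ} (hm : Continuous m) (hκ : Continuous κ)
    (hκ0 : κ 0 = 0) (hder : ∀ r, 0 < r → HasDerivAt m (κ r / r) r) :
    ContDiff ℝ 1 (fun z : V => m ‖z‖ • z) :=
  contDiff_one_iff_hasFDerivAt.2
    ⟨_, continuous_radialFieldDeriv hm hκ hκ0, hasFDerivAt_radialField hm hder⟩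

/-- The inverse `p ↦ p / √(1 + |p|²)` of the vectorial Minkowski flux. -/
noncomputable def vectorSlope (p : V) : V := (Real.sqrt (1 + ‖p‖ ^ 2))⁻¹ • p

lemma contDiff_vectorSlope : ContDiff ℝ 1 (vectorSlope : V → V) := by
  have h1 : ContDiff ℝ 1 (fun p : V => 1 + ‖p‖ ^ 2) := contDiff_const.add (contDiff_norm_sq ℝ)
  have h2 : ∀ p : V, 1 + ‖p‖ ^ 2 ≠ 0 := fun p => by positivity
  exact ((h1.sqrt h2).inv fun p => (sqrt_one_add_sq_pos _).ne').smul contDiff_id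

lemma norm_vectorSlope_sq (p : V) : ‖vectorSlope p‖ ^ 2 = ‖p‖ ^ 2 / (1 + ‖p‖ ^ 2) := by
  rw [vectorSlope, norm_smul, mul_pow, norm_inv, Real.norm_eq_abs, abs_of_pos
    (sqrt_one_add_sq_pos _), inv_pow, Real.sq_sqrt (by positivity)]
  field_simp

lemma norm_vectorSlope_lt_one (p : V) : ‖vectorSlope p‖ < 1 := by
  have h : ‖vectorSlope p‖ ^ 2 < 1 := by
    rw [norm_vectorSlope_sq, div_lt_one (by positivity)]
    linarith
  nlinarith [norm_nonneg (vectorSlope p)]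

lemma one_div_sqrt_smul_vectorSlope (p : V) :
    (1 / Real.sqrt (1 - ‖vectorSlope p‖ ^ 2)) • vectorSlope p = p := by
  have h : 1 - ‖vectorSlope p‖ ^ 2 = (1 + ‖p‖ ^ 2)⁻¹ := by
    rw [norm_vectorSlope_sq]
    field_simp
    ring
  rw [h, Real.sqrt_inv, one_div, inv_inv, vectorSlope, smul_smul,
    mul_inv_cancel₀ (sqrt_one_add_sq_pos _).ne', one_smul]

end RadialField

namespace IsProfile

variable {n : ℕ} {g u : ℝ → ℝ} {d : ℝ}

lemma hasDerivAt_mean (hu : IsProfile n g d u) (hg : Continuous g) {r : ℝ} (hr : r ≠ 0) :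
    HasDerivAt (mean n g u) ((g (u r) - (n + 1) * mean n g u r) / r) r := by
  have h := ((hu.hasDerivAt_momentum hg r).div (hasDerivAt_id' r) hr).neg
  refine (h.congr_of_eventuallyEq ?_).congr_deriv ?_
  · filter_upwards [isOpen_ne.mem_nhds hr] with s hs
    exact mean_eq hs
  · rw [momentum]
    field_simp
    ring

section Field

variable {V : Type*} [NormedAddCommGroup V] [InnerProductSpace ℝ V]

lemma contDiff_field (hu : IsProfile n g d u) (hg : Continuous g) :
    ContDiff ℝ 1 (fun z : V => -(mean n g u ‖z‖) • z) := by
  have hm := hu.continuous_mean hg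
  have := hu.continuous
  have h := contDiff_radialField (V := V) (m := mean n g u)
    (κ := fun r => g (u r) - (n + 1) * mean n g u r) hm (by fun_prop)
    (by rw [mean_zero]; field_simp; ring) (fun r hr => hu.hasDerivAt_mean hg hr.ne')
  simpa only [neg_smul] using h.neg

variable [CompleteSpace V]

/-- The gradient of `x ↦ u(|x|)`, at the origin included. -/
lemma hasGradientAt (hu : IsProfile n g d u) (x : V) :
    HasGradientAt (fun z : V => u ‖z‖) (vectorSlope (-(mean n g u ‖x‖) • x)) x := by
  rw [hasGradientAt_iff_hasFDerivAt]
  rcases eq_or_ne x 0 with rfl | hx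
  · have h0 : HasDerivAt u 0 ‖(0 : V)‖ := by simpa using hu.hasDerivAt 0
    have h1 := hasDerivAt_iff_isLittleO.1 h0
    rw [hasFDerivAt_iff_isLittleO_nhds_zero]
    have h2 := h1.comp_tendsto (k := fun z : V => ‖z‖) (continuous_norm.tendsto 0)
    simp only [Function.comp_def, norm_zero, smul_zero, sub_zero] at h2
    simpa [vectorSlope] using h2.of_norm_right
  · have hx' : 0 < ‖x‖ := norm_pos_iff.2 hx
    have h1 := (hu.hasDerivAt ‖x‖).comp_hasFDerivAt x (hasFDerivAt_norm_of_ne_zero hx)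
    refine h1.congr_fderiv ?_
    ext v
    have hn : ‖-(mean n g u ‖x‖) • x‖ ^ 2 = (-(‖x‖ * mean n g u ‖x‖)) ^ 2 := by
      rw [norm_smul, mul_pow, Real.norm_eq_abs, sq_abs]
      ring
    simp only [vectorSlope, hn, slope, InnerProductSpace.toDual_apply_apply, inner_smul_left]
    simp
    field_simp

lemma contDiff_comp_norm (hu : IsProfile n g d u) (hg : Continuous g) :
    ContDiff ℝ 2 (fun z : V => u ‖z‖) := by
  have hfd : fderiv ℝ (fun z : V => u ‖z‖) =
      fun x => innerSL ℝ (vectorSlope (-(mean n g u ‖x‖) • x)) := by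
    ext x v
    rw [(hasGradientAt_iff_hasFDerivAt.1 (hu.hasGradientAt x)).fderiv]
    simp
  rw [show (2 : WithTop ℕ∞) = 1 + 1 by norm_num, contDiff_succ_iff_fderiv]
  refine ⟨fun x => (hu.hasGradientAt x).differentiableAt, by simp, ?_⟩
  rw [hfd]
  exact (innerSL ℝ).contDiff.comp (contDiff_vectorSlope.comp (hu.contDiff_field hg))

end Field

lemma flux_eq (hu : IsProfile n g d u) {N : ℕ} :
    flux (fun z : EuclideanSpace ℝ (Fin N) => u ‖z‖) = fun z => -(mean n g u ‖z‖) • z := by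
  ext1 x
  rw [flux, (hu.hasGradientAt x).gradient, one_div_sqrt_smul_vectorSlope]

/-- The profile equation is the radial form of the Minkowski-curvature equation in dimension
`n + 1`, at the origin included. -/
lemma divergence_flux (hu : IsProfile n g d u) (hg : Continuous g)
    (x : EuclideanSpace ℝ (Fin (n + 1))) :
    divergence (flux (fun z : EuclideanSpace ℝ (Fin (n + 1)) => u ‖z‖)) x = -g (u ‖x‖) := by
  have hm := hu.continuous_mean hg
  have h := (hasFDerivAt_radialField (κ := fun r => g (u r) - (n + 1) * mean n g u r) hm
    (fun r hr => hu.hasDerivAt_mean hg hr.ne') x).neg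
  have hflux : flux (fun z : EuclideanSpace ℝ (Fin (n + 1)) => u ‖z‖) =
      -fun z => mean n g u ‖z‖ • z := by
    rw [hu.flux_eq]
    ext1 z
    simp
  rw [divergence, hflux, h.fderiv]
  have hterm : ∀ i : Fin (n + 1),
      (-radialFieldDeriv (mean n g u) (fun r => g (u r) - (n + 1) * mean n g u r) x)
        (EuclideanSpace.single i 1) i =
      -mean n g u ‖x‖ - (g (u ‖x‖) - (n + 1) * mean n g u ‖x‖) * (‖x‖ ^ 2)⁻¹ * x i ^ 2 := by
    intro i
    simp [radialFieldDeriv, EuclideanSpace.inner_single_right]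
    ring
  rw [Finset.sum_congr rfl fun i _ => hterm i, Finset.sum_sub_distrib, ← Finset.mul_sum,
    ← EuclideanSpace.real_norm_sq_eq]
  simp only [Finset.sum_const, Finset.card_univ, Fintype.card_fin, nsmul_eq_mul]
  push_cast
  rcases eq_or_ne x 0 with rfl | hx
  · simp only [norm_zero, mean_zero]
    field_simp
    ring
  · have hx' : ‖x‖ ≠ 0 := norm_ne_zero_iff.2 hx
    field_simp
    ring

lemma isRadialSolution (hu : IsProfile n g d u) (hg : Continuous g) {f : ℝ → ℝ} {R : ℝ}
    (hR : 0 < R) (hmom : momentum n g u R = 0) (hpos : ∀ r ∈ Ico 0 R, 0 < u r)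
    (hf : ∀ r ∈ Ico 0 R, g (u r) = f (u r)) : IsRadialSolution (n + 1) f R u := by
  have hmem : ∀ x ∈ Metric.ball (0 : EuclideanSpace ℝ (Fin (n + 1))) R, ‖x‖ ∈ Ico 0 R :=
    fun x hx => ⟨norm_nonneg x, by simpa using hx⟩
  refine ⟨(hu.contDiff_comp_norm hg).contDiffOn, fun x _ => ?_, fun x hx => ?_,
    fun x hx => hpos _ (hmem x hx), fun x hx => ?_⟩
  · rw [(hu.hasGradientAt x).gradient]
    exact norm_vectorSlope_lt_one _
  · rw [hu.divergence_flux hg, neg_neg, hf _ (hmem x hx)]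
  · have hxR : ‖x‖ = R := by simpa using hx
    have hmean : mean n g u R = 0 := by
      rw [mean_eq hR.ne', hmom]
      simp
    have hgrad := hasGradientAt_iff_hasFDerivAt.1 (hu.hasGradientAt x)
    have huniq : UniqueDiffWithinAt ℝ (Metric.closedBall 0 R) x := by
      refine uniqueDiffOn_convex (convex_closedBall _ _) ?_ x (Metric.sphere_subset_closedBall hx)
      rw [interior_closedBall _ hR.ne']
      exact ⟨0, Metric.mem_ball_self hR⟩
    rw [hgrad.hasFDerivWithinAt.fderivWithin huniq, hxR, hmean]
    simp [vectorSlope]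

end IsProfile

/-! ### Truncated nonlinearities -/

/-- The nonlinearity `f` extended by zero to the negative half-line and by the constant `f(B)`
beyond `B`, which makes it globally Lipschitz. -/
def truncate (f : ℝ → ℝ) (B s : ℝ) : ℝ := f (max 0 (min s B))

section Truncate

variable {f : ℝ → ℝ} {B : ℝ}

lemma truncate_eq {s : ℝ} (h0 : 0 ≤ s) (hB : s ≤ B) : truncate f B s = f s := by
  rw [truncate, min_eq_left hB, max_eq_right h0]

lemma truncate_of_nonpos (f_zero : f 0 = 0) {s : ℝ} (hs : s ≤ 0) : truncate f B s = 0 := by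
  rw [truncate, max_eq_left ((min_le_left _ _).trans hs), f_zero]

lemma isRestoring_truncate (hB : 1 < B) (f_zero : f 0 = 0) (f_one : f 1 = 0)
    (f_neg : ∀ s : ℝ, 0 < s → s < 1 → f s < 0) (f_pos : ∀ s : ℝ, 1 < s → 0 < f s) :
    IsRestoring (truncate f B) where
  nonpos s hs := truncate_of_nonpos f_zero hs
  neg s h0 h1 := by
    rw [truncate_eq h0.le (h1.trans hB).le]
    exact f_neg s h0 h1
  one := by rw [truncate_eq zero_le_one hB.le, f_one]
  pos s hs := f_pos _ (lt_max_of_lt_right (lt_min hs hB))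

lemma exists_lipschitzWith_truncate (hB : 0 ≤ B) (f_reg : ContDiffOn ℝ 1 f (Ici 0)) :
    ∃ L : ℝ≥0, LipschitzWith L (truncate f B) := by
  obtain ⟨L, hL⟩ := (f_reg.mono (Icc_subset_Ici_self : Icc 0 B ⊆ Ici 0)).exists_lipschitzOnWith
    one_ne_zero (convex_Icc 0 B) isCompact_Icc
  refine ⟨L, LipschitzWith.of_dist_le_mul fun s t => ?_⟩
  have hmem : ∀ s : ℝ, max 0 (min s B) ∈ Icc 0 B := fun s =>
    ⟨le_max_left _ _, max_le hB (min_le_right _ _)⟩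
  have h1 : LipschitzWith 1 (fun s : ℝ => max 0 (min s B)) :=
    (LipschitzWith.id.min_const B).const_max 0
  refine (hL.dist_le_mul _ (hmem s) _ (hmem t)).trans ?_
  gcongr
  simpa using h1.dist_le_mul s t

lemma hasDerivAt_truncate (hB : 1 < B) (f_reg : ContDiffOn ℝ 1 f (Ici 0))
    (f_deriv : deriv f 1 = 0) : HasDerivAt (truncate f B) 0 1 := by
  have h : HasDerivAt f 0 1 := by
    rw [← f_deriv]
    exact ((f_reg.contDiffAt (Ici_mem_nhds one_pos)).differentiableAt one_ne_zero).hasDerivAt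
  refine h.congr_of_eventuallyEq ?_
  filter_upwards [Ioo_mem_nhds one_pos hB] with s hs using truncate_eq hs.1.le hs.2.le

end Truncate

/-! ### Selection of the initial values -/

/-- A continuous angle that is small at both ends of an interval and exceeds `k π` inside takes
each of the values `π, …, k π` once on either side of the interior point. The `2 k` solutions are
enumerated so that the `j`-th and the `(2 k + 1 - j)`-th share the value `j π`. -/
lemma exists_injOn_eq_min_mul_pi {θ : ℝ → ℝ} {a e b : ℝ} (hae : a ≤ e) (heb : e ≤ b)
    (hθ : ContinuousOn θ (Icc a b)) (ha : θ a < Real.pi / 2) (hb : θ b < Real.pi / 2) {k : ℕ}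
    (he : k * Real.pi < θ e) :
    ∃ D : ℕ → ℝ, InjOn D (Icc 1 (2 * k)) ∧ ∀ j ∈ Icc 1 (2 * k), D j ∈ Icc a b ∧
      θ (D j) = (min j (2 * k + 1 - j) : ℕ) * Real.pi := by
  have hπ := Real.pi_pos
  have hval : ∀ i : ℕ, 1 ≤ i → i ≤ k → Real.pi / 2 < i * Real.pi ∧ (i : ℝ) * Real.pi < θ e := by
    intro i h1 hk
    have h1' : (1 : ℝ) ≤ i := by exact_mod_cast h1
    have hk' : (i : ℝ) ≤ k := by exact_mod_cast hk
    exact ⟨by nlinarith, lt_of_le_of_lt (by gcongr) he⟩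
  have hleft : ∀ i : ℕ, 1 ≤ i → i ≤ k → ∃ d ∈ Ioo a e, θ d = i * Real.pi := fun i h1 hk =>
    intermediate_value_Ioo hae (hθ.mono (Icc_subset_Icc_right heb))
      ⟨ha.trans (hval i h1 hk).1, (hval i h1 hk).2⟩
  have hright : ∀ i : ℕ, 1 ≤ i → i ≤ k → ∃ d ∈ Ioo e b, θ d = i * Real.pi := fun i h1 hk =>
    intermediate_value_Ioo' heb (hθ.mono (Icc_subset_Icc_left hae))
      ⟨hb.trans (hval i h1 hk).1, (hval i h1 hk).2⟩
  choose! l hl hlθ using hleft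
  choose! r hr hrθ using hright
  have hDval : ∀ j ∈ Icc 1 (2 * k), θ (if j ≤ k then l j else r (2 * k + 1 - j)) =
      (min j (2 * k + 1 - j) : ℕ) * Real.pi := by
    rintro j ⟨h1, h2⟩
    split_ifs with hj
    · rw [hlθ j h1 hj, min_eq_left (by omega)]
    · rw [hrθ _ (by omega) (by omega), min_eq_right (by omega)]
  refine ⟨fun j => if j ≤ k then l j else r (2 * k + 1 - j), ?_, fun j hj => ⟨?_, hDval j hj⟩⟩
  · intro i hi j hj hij
    have hmin : min i (2 * k + 1 - i) = min j (2 * k + 1 - j) := by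
      have h := hDval i hi
      simp only at hij
      rw [hij, hDval j hj] at h
      exact_mod_cast (mul_right_cancel₀ hπ.ne' h).symm
    obtain ⟨hi1, hi2⟩ := hi
    obtain ⟨hj1, hj2⟩ := hj
    simp only at hij
    split_ifs at hij with h1 h2 h2
    · omega
    · have h3 := (hl i hi1 h1).2
      have h4 := (hr (2 * k + 1 - j) (by omega) (by omega)).1
      linarith
    · have h3 := (hl j hj1 h2).2
      have h4 := (hr (2 * k + 1 - i) (by omega) (by omega)).1
      linarith
    · omega
  · obtain ⟨h1, h2⟩ := hj
    simp only
    split_ifs with h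
    · exact ⟨(hl j h1 h).1.le, (hl j h1 h).2.le.trans heb⟩
    · have h3 := hr (2 * k + 1 - j) (by omega) (by omega)
      exact ⟨hae.trans h3.1.le, h3.2.le⟩

end LorentzMinkowski

open LorentzMinkowski in
theorem theorem1p1 (N : ℕ) (hN : 1 ≤ N) (f : ℝ → ℝ)
    (f_reg : ContDiffOn ℝ 1 f (Ici 0))
    (f_zero : f 0 = 0) (f_one : f 1 = 0)
    (f_neg : ∀ s : ℝ, 0 < s → s < 1 → f s < 0)
    (f_pos : ∀ s : ℝ, 1 < s → 0 < f s)
    (f_deriv : deriv f 1 = 0)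
    (k : ℕ) (hk : 1 ≤ k) :
    ∃ Rstar : ℝ, 0 < Rstar ∧ ∀ R : ℝ, Rstar ≤ R →
      ∃ uPlus uMinus : ℕ → ℝ → ℝ,
        -- each of them solves the problem and is non-constant
        (∀ j ∈ Icc 1 (2 * k),
          LorentzMinkowski.IsRadialSolution N f R (uPlus j) ∧
          LorentzMinkowski.IsRadialSolution N f R (uMinus j) ∧
          (∃ r ∈ Ico 0 R, ∃ s ∈ Ico 0 R, uPlus j r ≠ uPlus j s) ∧
          (∃ r ∈ Ico 0 R, ∃ s ∈ Ico 0 R, uMinus j r ≠ uMinus j s)) ∧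
        -- the 4k functions are pairwise distinct on the ball
        (∀ i ∈ Icc 1 (2 * k), ∀ j ∈ Icc 1 (2 * k), i ≠ j →
          ¬ EqOn (uPlus i) (uPlus j) (Ico 0 R) ∧
          ¬ EqOn (uMinus i) (uMinus j) (Ico 0 R)) ∧
        (∀ i ∈ Icc 1 (2 * k), ∀ j ∈ Icc 1 (2 * k),
          ¬ EqOn (uPlus i) (uMinus j) (Ico 0 R)) ∧
        -- value at the origin
        (∀ j ∈ Icc 1 (2 * k), 1 < uPlus j 0 ∧ uMinus j 0 < 1) ∧
        -- number of zeros
        (∀ j ∈ Icc 1 k,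
          {r ∈ Ioo 0 R | uPlus j r - 1 = 0}.encard = (j : ℕ∞) ∧
          {r ∈ Ioo 0 R | uMinus j r - 1 = 0}.encard = (j : ℕ∞) ∧
          {r ∈ Ioo 0 R | uPlus (2 * k + 1 - j) r - 1 = 0}.encard = (j : ℕ∞) ∧
          {r ∈ Ioo 0 R | uMinus (2 * k + 1 - j) r - 1 = 0}.encard = (j : ℕ∞)) := by
  obtain ⟨n, rfl⟩ : ∃ n, N = n + 1 := ⟨N - 1, by omega⟩
  -- The constants of the shell come from the truncation at `2`, hence do not depend on `R`.
  obtain ⟨L₂, hL₂⟩ := exists_lipschitzWith_truncate (B := 2) zero_le_two f_reg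
  obtain ⟨c, hc, ω, hω, hshell₂⟩ := (isRestoring_truncate one_lt_two f_zero f_one f_neg
    f_pos).exists_rotatesOnShell hL₂.continuous
  set M : ℝ := (2 * k + 1) * Real.pi / ω with hM
  have hMpos : 0 < M := by have := Real.pi_pos; positivity
  have hMω : ω / 2 * M - Real.pi / 2 = k * Real.pi := by
    rw [hM]
    field_simp
    ring
  refine ⟨M + 1 + n * (1 + c) * M / (c / 2) + n / ω, by positivity, fun R hR => ?_⟩
  set ρ : ℝ := R - M with hρdef
  have hRρ : R = ρ + M := by ring
  have hq₁ : 0 ≤ n * (1 + c) * M / (c / 2) := by positivity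
  have hq₂ : 0 ≤ n / ω := by positivity
  have hρ : 0 < ρ := by linarith
  have hRpos : 0 < R := by linarith
  have hloss : n / ρ * (1 + c) * M ≤ c / 2 := by
    have h : n * (1 + c) * M / (c / 2) ≤ ρ := by linarith
    rw [div_le_iff₀ (by positivity)] at h
    calc n / ρ * (1 + c) * M = n * (1 + c) * M / ρ := by ring
      _ ≤ c / 2 := (div_le_iff₀' hρ).2 h
  have hdamp : n / ρ ≤ ω := by
    have h : n / ω ≤ ρ := by linarith
    rw [div_le_iff₀ hω] at h
    exact (div_le_iff₀' hρ).2 h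
  -- Profiles starting below `R + 2` stay below `2 R + 2` up to `R`, where the truncation is
  -- invisible.
  set B : ℝ := 2 * R + 2 with hB
  have hB2 : 2 ≤ B := by linarith
  set g : ℝ → ℝ := truncate f B with hgdef
  obtain ⟨L, hL⟩ := exists_lipschitzWith_truncate (B := B) (by linarith) f_reg
  have hgr : IsRestoring g := isRestoring_truncate (by linarith) f_zero f_one f_neg f_pos
  have hshell : RotatesOnShell g c ω := by
    refine hshell₂.congr hgr hL.continuous fun s hs => ?_
    rw [hgdef, truncate, truncate, min_eq_left (le_trans hs hB2), min_eq_left hs]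
  obtain ⟨u, hu, hlip, hcont, hconst⟩ := exists_profile_family n hL
  have hone := hconst 1 hgr.one
  have hzero := hconst 0 (hgr.nonpos 0 le_rfl)
  obtain ⟨⟨e₁, he₁, hangle₁⟩, e₂, he₂, hangle₂⟩ :=
    exists_lt_angle hu hL hcont hgr hone hzero hshell hc hρ hMpos.le hloss hdamp
  rw [hMω, ← hRρ] at hangle₁ hangle₂
  obtain ⟨δ, hδ, hnear⟩ := exists_forall_near_one_ne_one hu hlip hone hgr.one
    (hasDerivAt_truncate (by linarith) f_reg f_deriv) hRpos
  obtain ⟨δ₀, hδ₀, hnear₀⟩ := exists_forall_near_zero_ne_one hlip hzero R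
  have hsmall : ∀ d, d ≠ 1 → (∀ r ∈ Icc 0 R, u d r ≠ 1) → angle n g (u d) R < Real.pi / 2 :=
    fun d hd h => angle_lt_of_ne_one (hu d) hL hgr.one hd hRpos.le h
  have hangc := continuousOn_angle_family (n := n) hu hL hcont hgr.one R
  -- Initial values above `1`.
  obtain ⟨D₂, hD₂inj, hD₂⟩ : ∃ D : ℕ → ℝ, InjOn D (Icc 1 (2 * k)) ∧ ∀ j ∈ Icc 1 (2 * k),
      D j ∈ Ioc 1 (R + 2) ∧
      angle n g (u (D j)) R = (min j (2 * k + 1 - j) : ℕ) * Real.pi := by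
    set a : ℝ := 1 + min (δ / 2) (e₂ - 1) with ha
    have hmin : 0 < min (δ / 2) (e₂ - 1) := lt_min (by linarith) (by linarith [he₂.1])
    have ha1 : 1 < a := by linarith
    have hae : a ≤ e₂ := by linarith [min_le_right (δ / 2) (e₂ - 1)]
    obtain ⟨D, hinj, hD⟩ := exists_injOn_eq_min_mul_pi (θ := fun d => angle n g (u d) R)
      (b := R + 2) hae (by linarith [he₂.2])
      (hangc.mono fun d hd => (ha1.trans_le hd.1).ne')
      (hsmall a ha1.ne' (hnear a ha1.ne' (by
        rw [ha, add_sub_cancel_left, abs_of_pos hmin]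
        linarith [min_le_left (δ / 2) (e₂ - 1)])))
      (hsmall _ (by linarith) fun r hr heq => by
        have := (abs_le.1 ((hu (R + 2)).abs_sub_init_le r)).1
        rw [heq, abs_of_nonneg hr.1] at this
        linarith [hr.2]) hangle₂
    exact ⟨D, hinj, fun j hj => ⟨⟨ha1.trans_le (hD j hj).1.1, (hD j hj).1.2⟩, (hD j hj).2⟩⟩
  -- Initial values below `1`.
  obtain ⟨D₁, hD₁inj, hD₁⟩ : ∃ D : ℕ → ℝ, InjOn D (Icc 1 (2 * k)) ∧ ∀ j ∈ Icc 1 (2 * k),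
      D j ∈ Ioo 0 1 ∧ angle n g (u (D j)) R = (min j (2 * k + 1 - j) : ℕ) * Real.pi := by
    set a : ℝ := min (δ₀ / 2) e₁ with ha
    have ha0 : 0 < a := lt_min (by linarith) he₁.1
    have hae : a ≤ e₁ := min_le_right _ _
    set b : ℝ := 1 - min (δ / 2) (1 - e₁) with hb
    have hmin : 0 < min (δ / 2) (1 - e₁) := lt_min (by linarith) (by linarith [he₁.2])
    have hb1 : b < 1 := by linarith
    have heb : e₁ ≤ b := by linarith [min_le_right (δ / 2) (1 - e₁)]
    obtain ⟨D, hinj, hD⟩ := exists_injOn_eq_min_mul_pi (θ := fun d => angle n g (u d) R)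
      hae heb (hangc.mono fun d hd => (lt_of_le_of_lt hd.2 hb1).ne)
      (hsmall a (by linarith [he₁.2]) (hnear₀ a (by
        rw [abs_of_pos ha0]
        linarith [min_le_left (δ₀ / 2) e₁])))
      (hsmall b hb1.ne (hnear b hb1.ne (by
        rw [hb, abs_sub_comm, sub_sub_cancel, abs_of_pos hmin]
        linarith [min_le_left (δ / 2) (1 - e₁)]))) hangle₁
    exact ⟨D, hinj, fun j hj => ⟨⟨ha0.trans_le (hD j hj).1.1, (hD j hj).1.2.trans_lt hb1⟩,
      (hD j hj).2⟩⟩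
  have hzeros : ∀ d, d ≠ 1 → ∀ j : ℕ, angle n g (u d) R = j * Real.pi →
      {r ∈ Ioo 0 R | u d r - 1 = 0}.encard = j := by
    intro d hd j hj
    have h := encard_cos_eq_zero ((hu d).hasDerivAt_angle hL hgr.one hd) (angle_zero _ _ _)
      (fun r hr => (hu d).angularVelocity_pos_of_cos_eq_zero hL hgr.one hd hr) hRpos hj
    simpa only [(hu d).cos_angle_eq_zero_iff hL hgr.one hd] using h
  have hsol : ∀ d, 0 < d → d ≤ R + 2 → d ≠ 1 → ∀ j : ℕ, angle n g (u d) R = j * Real.pi →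
      IsRadialSolution (n + 1) f R (u d) := by
    intro d hd0 hdR hd j hj
    have hmom := (hu d).momentum_eq_zero_of_angle hL hgr.one hd hj
    have hpos : ∀ r ∈ Ico 0 R, 0 < u d r := fun r hr =>
      (hu d).pos_of_momentum_eq_zero hL hgr hd0 hmom (Ico_subset_Icc_self hr)
    refine (hu d).isRadialSolution hL.continuous hRpos hmom hpos fun r hr => ?_
    refine truncate_eq (hpos r hr).le ?_
    have := (abs_le.1 ((hu d).abs_sub_init_le r)).2
    rw [abs_of_nonneg hr.1] at this
    linarith [hr.2]
  have hnonconst : ∀ d, d ≠ 1 → ∀ j : ℕ, 1 ≤ j → angle n g (u d) R = j * Real.pi →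
      ∃ r ∈ Ico 0 R, ∃ s ∈ Ico 0 R, u d r ≠ u d s := by
    intro d hd j hj1 hj
    obtain ⟨r, hr, hr1⟩ : {r ∈ Ioo 0 R | u d r - 1 = 0}.Nonempty := by
      rw [← Set.encard_ne_zero, hzeros d hd j hj]
      exact_mod_cast (by omega : j ≠ 0)
    refine ⟨0, ⟨le_rfl, hRpos⟩, r, Ioo_subset_Ico_self hr, ?_⟩
    rw [(hu d).init, sub_eq_zero.1 hr1]
    exact hd
  have hmin1 : ∀ j ∈ Icc 1 (2 * k), 1 ≤ min j (2 * k + 1 - j) := fun j hj =>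
    le_min hj.1 (by have := hj.2; omega)
  have h0mem : (0 : ℝ) ∈ Ico 0 R := ⟨le_rfl, hRpos⟩
  refine ⟨fun j => u (D₂ j), fun j => u (D₁ j), fun j hj => ⟨?_, ?_, ?_, ?_⟩,
    fun i hi j hj hij => ⟨fun h => ?_, fun h => ?_⟩, fun i hi j hj h => ?_, fun j hj => ?_,
    fun j hj => ?_⟩
  · obtain ⟨hd, hθ⟩ := hD₂ j hj
    exact hsol _ (zero_lt_one.trans hd.1) hd.2 hd.1.ne' _ hθ
  · obtain ⟨hd, hθ⟩ := hD₁ j hj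
    exact hsol _ hd.1 (by linarith [hd.2]) hd.2.ne _ hθ
  · obtain ⟨hd, hθ⟩ := hD₂ j hj
    exact hnonconst _ hd.1.ne' _ (hmin1 j hj) hθ
  · obtain ⟨hd, hθ⟩ := hD₁ j hj
    exact hnonconst _ hd.2.ne _ (hmin1 j hj) hθ
  · have h0 := h h0mem
    simp only [(hu _).init] at h0
    exact hij (hD₂inj hi hj h0)
  · have h0 := h h0mem
    simp only [(hu _).init] at h0
    exact hij (hD₁inj hi hj h0)
  · have h0 := h h0mem
    simp only [(hu _).init] at h0
    linarith [(hD₂ i hi).1.1, (hD₁ j hj).1.2]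
  · simp only [(hu _).init]
    exact ⟨(hD₂ j hj).1.1, (hD₁ j hj).1.2⟩
  · have hj1 := hj.1
    have hj2 := hj.2
    have hm : j ∈ Icc 1 (2 * k) := ⟨hj1, by omega⟩
    have hm' : 2 * k + 1 - j ∈ Icc 1 (2 * k) := ⟨by omega, by omega⟩
    have e1 : min j (2 * k + 1 - j) = j := by omega
    have e2 : min (2 * k + 1 - j) (2 * k + 1 - (2 * k + 1 - j)) = j := by omega
    obtain ⟨hp, hpθ⟩ := hD₂ j hm
    obtain ⟨hp', hpθ'⟩ := hD₂ _ hm'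
    obtain ⟨hq, hqθ⟩ := hD₁ j hm
    obtain ⟨hq', hqθ'⟩ := hD₁ _ hm'
    rw [e1] at hpθ hqθ
    rw [e2] at hpθ' hqθ'
    exact ⟨hzeros _ hp.1.ne' j hpθ, hzeros _ hq.2.ne j hqθ, hzeros _ hp'.1.ne' j hpθ',
      hzeros _ hq'.2.ne j hqθ'⟩
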